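/- Let $N\ge 1$ and $d$ be integers, $A\in\mathbb{R}^{N\times N}$, $B\in\mathbb{R}^{N\times d}$ with $\operatorname{rank}B=d$, and assume the Kalman condition $\operatorname{rank}[B,AB,\dots,A^{N-1}B]=N$. Let $\alpha\in(0,2)$, $r_0>0$, and let $\mu$ be a finite measure on the unit sphere $\mathbb{S}^{d-1}$ that is non-degenerate: there is $\eta\ge1$ with $\eta^{-1}|p|^\alpha\le\int_{\mathbb{S}^{d-1}}|p\cdot s|^\alpha\,\mu(ds)\le\eta|p|^\alpha$ for all $p\in\mathbb{R}^d$. Let $n$ be the least $r$ with $\operatorname{rank}[B,AB,\dots,A^{r-1}B]=N$; let $V_0=\{0\}$, $V_h=\operatorname{Im}B+\dots+\operatorname{Im}A^{h-1}B$, and let $E_h$ be the orthogonal projection of $\mathbb{R}^N$ onto $V_{h-1}^\perp\cap V_h$, $1\le h\le n$. Put $\mathbb{M}_t=\sum_{h=1}^n t^{h-1}E_h$ for $t\ge 0$, $R_0=I$, $R_t=\mathbb{M}_t^{-1}e^{tA}\mathbb{M}_t$ for $t>0$, and $$\rho:=r_0\cdot\inf\{|\mathbb{M}_sR_{st}B\theta|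 : s\in(0,1),\ t\in(0,1],\ \theta\in\mathbb{S}^{d-1}\}.$$ For $t\in(0,1]$ let $\tilde\mu^t$ be the image of the measure $|\mathbb{M}_sR_{st}B\theta|^\alpha\,\mu(d\theta)\,ds$ on $[0,1]\times\mathbb{S}^{d-1}$ under $(s,\theta)\mapsto \mathbb{M}_sR_{st}B\theta/|\mathbb{M}_sR_{st}B\theta|\in\mathbb{S}^{N-1}$, and let $$\nu^t_\alpha(C)=\int_0^{\rho}\int_{\mathbb{S}^{N-1}}\mathbf 1_C(r\theta)\,\tilde\mu^t(d\theta)\frac{dr}{r^{1+\alpha}},\qquad \Phi^{\mathrm{tr}}_t(\xi)=\int_{|z|\le t^{1/\alpha}}\bigl[1-e^{i\langle\xi,z\rangle}+i\langle\xi,z\rangle\bigr]\,\nu^t_\alpha(dz),\quad \xi\in\mathbb{R}^N .$$ The truncated stable law $\mathbb{P}^{\mathrm{tr}}_t$ is the probability measure on $\mathbb{R}^N$ with characteristic function $\widehat{\mathbb{P}^{\mathrm{tr}}_t}(\xi)=\exp[-t\,\Phi^{\mathrm{tr}}_t(\xi)]$. **Proposition.** For every integer $m\ge0$ there is $T_0=T_0(m)\in(0,1]$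 such that for every $t\in(0,T_0]$ the probability measure $\mathbb{P}^{\mathrm{tr}}_t$ exists and has a density $p^{\mathrm{tr}}(t,\cdot)\ge0$ that is $m$ times continuously differentiable on $\mathbb{R}^N$. Moreover, for every integer $k$ with $0\le k\le m$ there is a constant $C=C(m,k)>0$ such that, for every multi-index $\vartheta\in\mathbb{N}_0^N$ with $|\vartheta|=k$, $$|D^\vartheta p^{\mathrm{tr}}(t,y)|\le C\,t^{-\frac{N+|\vartheta|}{\alpha}}\Bigl(1+\frac{|y|}{t^{1/\alpha}}\Bigr)^{|\vartheta|-m},\qquad t\in(0,T_0],\ y\in\mathbb{R}^N .$$ ($T_0$ and $C$ may also depend on the fixed data $N,d,A,B,\alpha,r_0,\mu$.) -/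

import Mathlib

open MeasureTheory Set

noncomputable section

/-- `ℝᴺ` with its Euclidean norm. -/
abbrev RSp (N : ℕ) : Type := EuclideanSpace ℝ (Fin N)

/-- The block matrix `[B, AB, …, A^{r-1}B]`; the column `(k, j)` is the `j`-th column of `A^k B`. -/
def kalmanMatrix {N d : ℕ} (A : Matrix (Fin N) (Fin N) ℝ) (B : Matrix (Fin N) (Fin d) ℝ) (r : ℕ) :
    Matrix (Fin N) (Fin r × Fin d) ℝ :=
  Matrix.of fun i kj => (A ^ (kj.1 : ℕ) * B) i kj.2

/-- The least `r` such that `[B, AB, …, A^{r-1}B]` has rank `N`. -/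
def kalmanIndex {N d : ℕ} (A : Matrix (Fin N) (Fin N) ℝ) (B : Matrix (Fin N) (Fin d) ℝ) : ℕ :=
  sInf {r : ℕ | (kalmanMatrix A B r).rank = N}

/-- The subspace `V_h = Im B + Im (AB) + ⋯ + Im (A^{h-1}B)` of `ℝᴺ` (so `V_0 = 0`). -/
def flagSpace {N d : ℕ} (A : Matrix (Fin N) (Fin N) ℝ) (B : Matrix (Fin N) (Fin d) ℝ) (h : ℕ) :
    Submodule ℝ (RSp N) :=
  ⨆ k : Fin h, LinearMap.range (Matrix.toEuclideanLin (A ^ (k : ℕ) * B))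

/-- The orthogonal projection of `ℝᴺ` onto `V_hᗮ ∩ V_{h+1}`. The index is shifted by one:
this is the projection usually numbered `h + 1`. -/
def flagProj {N d : ℕ} (A : Matrix (Fin N) (Fin N) ℝ) (B : Matrix (Fin N) (Fin d) ℝ) (h : ℕ) :
    RSp N →L[ℝ] RSp N :=
  ((flagSpace A B h)ᗮ ⊓ flagSpace A B (h + 1)).starProjection

/-- The intrinsic dilation `𝕄_t`, acting as multiplication by `t^h` on `V_hᗮ ∩ V_{h+1}`
for `0 ≤ h < n`, `n` the Kalman index. In an orthonormal basis adapted to the flag it is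
`diag(I, t I, …, t^{n-1} I)`. -/
def dilation {N d : ℕ} (A : Matrix (Fin N) (Fin N) ℝ) (B : Matrix (Fin N) (Fin d) ℝ) (t : ℝ) :
    RSp N →L[ℝ] RSp N :=
  ∑ h ∈ Finset.range (kalmanIndex A B), t ^ h • flagProj A B h

/-- `R_t = 𝕄_t⁻¹ e^{tA} 𝕄_t` for `t ≠ 0`, and `R_0 = I`. -/
def resolventMap {N d : ℕ} (A : Matrix (Fin N) (Fin N) ℝ) (B : Matrix (Fin N) (Fin d) ℝ) (t : ℝ) :
    RSp N →L[ℝ] RSp N :=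
  if t = 0 then 1
  else Ring.inverse (dilation A B t) * NormedSpace.exp (t • Matrix.toEuclideanCLM (𝕜 := ℝ) A) *
    dilation A B t

/-- The vector `𝕄_s R_{st} B θ` of `ℝᴺ`, for `θ ∈ ℝᵈ`. -/
def transported {N d : ℕ} (A : Matrix (Fin N) (Fin N) ℝ) (B : Matrix (Fin N) (Fin d) ℝ)
    (t s : ℝ) (θ : RSp d) : RSp N :=
  dilation A B s (resolventMap A B (s * t) (Matrix.toEuclideanLin B θ))

/-- The infimum of `|𝕄_s R_{st} B θ|` over `s ∈ (0,1)`, `t ∈ (0,1]` and unit vectors `θ`. -/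
def transportedInf {N d : ℕ} (A : Matrix (Fin N) (Fin N) ℝ) (B : Matrix (Fin N) (Fin d) ℝ) : ℝ :=
  sInf {x : ℝ | ∃ s ∈ Ioo (0 : ℝ) 1, ∃ t ∈ Ioc (0 : ℝ) 1, ∃ θ ∈ Metric.sphere (0 : RSp d) 1,
    x = ‖transported A B t s θ‖}

/-- A measure on `ℝᵈ` which is finite and carried by the unit sphere, and non-degenerate with
exponent `α`: `η⁻¹ |p|^α ≤ ∫ |p · s|^α μ(ds) ≤ η |p|^α` for some `η ≥ 1` and all `p`. -/
structure IsNondegSpherical {d : ℕ} (α : ℝ) (μ : Measure (RSp d)) : Prop where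
  finite : IsFiniteMeasure μ
  carried : μ (Metric.sphere (0 : RSp d) 1)ᶜ = 0
  nondeg : ∃ η : ℝ, 1 ≤ η ∧ ∀ p : RSp d,
    η⁻¹ * ‖p‖ ^ α ≤ ∫ s, |inner ℝ p s| ^ α ∂μ ∧ ∫ s, |inner ℝ p s| ^ α ∂μ ≤ η * ‖p‖ ^ α

/-- The spherical measure `μ̃^t` on `ℝᴺ`: the image of `|𝕄_s R_{st} B θ|^α μ(dθ) ds` on
`[0,1] × S^{d-1}` under `(s, θ) ↦ 𝕄_s R_{st} B θ / |𝕄_s R_{st} B θ|`. -/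
def sphericalPart {N d : ℕ} (A : Matrix (Fin N) (Fin N) ℝ) (B : Matrix (Fin N) (Fin d) ℝ)
    (α : ℝ) (μ : Measure (RSp d)) (t : ℝ) : Measure (RSp N) :=
  ((((volume : Measure ℝ).restrict (Icc 0 1)).prod μ).withDensity
      fun sθ => ENNReal.ofReal (‖transported A B t sθ.1 sθ.2‖ ^ α)).map
    fun sθ => ‖transported A B t sθ.1 sθ.2‖⁻¹ • transported A B t sθ.1 sθ.2

/-- The measure `C ↦ ∫_0^ρ ∫ 1_C(r θ) σ(dθ) dr / r^{1+α}`. -/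
def polarMeasure {N : ℕ} (α ρ : ℝ) (σ : Measure (RSp N)) : Measure (RSp N) :=
  ((((volume : Measure ℝ).restrict (Ioc 0 ρ)).withDensity
      fun r => ENNReal.ofReal (1 / r ^ (1 + α))).prod σ).map fun rθ => rθ.1 • rθ.2

/-- The `α`-stable-type Lévy measure `ν^t_α` on `ℝᴺ`, with spherical part `μ̃^t` and jumps of size
at most `r₀ · inf |𝕄_s R_{st} B θ|`. -/
def stableLevyMeasure {N d : ℕ} (A : Matrix (Fin N) (Fin N) ℝ) (B : Matrix (Fin N) (Fin d) ℝ)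
    (α r₀ : ℝ) (μ : Measure (RSp d)) (t : ℝ) : Measure (RSp N) :=
  polarMeasure α (r₀ * transportedInf A B) (sphericalPart A B α μ t)

/-- The symbol `∫_{|z| ≤ t^{1/α}} (1 - e^{i⟨ξ,z⟩} + i⟨ξ,z⟩) ν^t_α(dz)`. -/
def truncSymbol {N d : ℕ} (A : Matrix (Fin N) (Fin N) ℝ) (B : Matrix (Fin N) (Fin d) ℝ)
    (α r₀ : ℝ) (μ : Measure (RSp d)) (t : ℝ) (ξ : RSp N) : ℂ :=
  ∫ z in Metric.closedBall (0 : RSp N) (t ^ (1 / α)),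
    (1 - Complex.exp (Complex.I * (inner ℝ ξ z : ℝ)) + Complex.I * (inner ℝ ξ z : ℝ))
    ∂(stableLevyMeasure A B α r₀ μ t)

/-- `P` is the truncated stable law at time `t`: the probability measure whose characteristic
function is `exp (- t Φ^tr_t)`. At most one `P` has this property (`IsTruncLaw.unique`). -/
structure IsTruncLaw {N d : ℕ} (A : Matrix (Fin N) (Fin N) ℝ) (B : Matrix (Fin N) (Fin d) ℝ)
    (α r₀ : ℝ) (μ : Measure (RSp d)) (t : ℝ) (P : Measure (RSp N)) : Prop where
  isProb : IsProbabilityMeasure P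
  charFun_eq : ∀ ξ : RSp N, charFun P ξ = Complex.exp (-(t * truncSymbol A B α r₀ μ t ξ))

theorem IsTruncLaw.unique {N d : ℕ} {A : Matrix (Fin N) (Fin N) ℝ} {B : Matrix (Fin N) (Fin d) ℝ}
    {α r₀ : ℝ} {μ : Measure (RSp d)} {t : ℝ} {P P' : Measure (RSp N)}
    (h : IsTruncLaw A B α r₀ μ t P) (h' : IsTruncLaw A B α r₀ μ t P') : P = P' := by
  have := h.isProb
  have := h'.isProb
  exact Measure.ext_of_charFun (funext fun ξ => (h.charFun_eq ξ).trans (h'.charFun_eq ξ).symm)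

/-- The partial derivative `∂f/∂x_i`. -/
def pderivative {N : ℕ} (i : Fin N) (f : RSp N → ℝ) : RSp N → ℝ :=
  fun y => lineDeriv ℝ f y (EuclideanSpace.single i (1 : ℝ))

/-- The mixed partial derivative `D^ϑ f = ∂_1^{ϑ_1} ⋯ ∂_N^{ϑ_N} f` for a multi-index `ϑ`. -/
def multiDeriv {N : ℕ} (ϑ : Fin N → ℕ) (f : RSp N → ℝ) : RSp N → ℝ :=
  (List.finRange N).foldr (fun i g => (pderivative i)^[ϑ i] g) f

end

/-!
After rescaling space by `t^{1/α}`, the truncated symbol `t Φ^tr_t` becomes the Lévy symbol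
`Ψ` of `polarMeasure α 1 (sphericalPart A B α μ t)`, which depends on `t` only through its
spherical part `μ̃^t`. The quadratic forms `ω ↦ ∫ ⟨ω, θ⟩² μ̃^t(dθ)` are definite uniformly in
`t ∈ (0, 1]`. Indeed `𝕄_s R_{st} B = 𝕄_t⁻¹ e^{stA} B` is a power series in `s` whose `k`-th
coefficient `∑_{h ≤ k} t^{k-h} E_h A^k B / k!` makes sense at `t = 0`, because `E_h A^k B = 0` for
`h > k` (flag indexed from `h = 0`). For each `t ∈ [0, 1]` a vector orthogonal to the images of all
coefficients vanishes, by induction along the flag, and `[0, 1]` is compact. Integrating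
`1 - cos ⟨ξ, z⟩` over `|z| ≤ |ξ|⁻¹` then yields `Re Ψ(ξ) ≥ b (|ξ|^α - 1)` with `b > 0` independent
of `t`.

The jumps are bounded by `1`, so `Ψ` is smooth with at most quadratic growth, and the functions
`exp (-Ψ)` form a bounded subset of the Schwartz space; so do their inverse Fourier transforms.
These are nonnegative because `exp (-Ψ)` is a pointwise limit of characteristic functions of
compound Poisson laws, hence a characteristic function by Lévy's continuity theorem. Undoing the
scaling turns the Schwartz bounds into the stated estimates.
-/

section Flag

theorem starProjection_orthogonal_inf {𝕜 E : Type*} [RCLike 𝕜] [NormedAddCommGroup E]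
    [InnerProductSpace 𝕜 E] {U W : Submodule 𝕜 E} [U.HasOrthogonalProjection]
    [W.HasOrthogonalProjection] [(Uᗮ ⊓ W).HasOrthogonalProjection] (h : U ≤ W) :
    (Uᗮ ⊓ W).starProjection = W.starProjection - U.starProjection := by
  ext x
  refine Submodule.eq_starProjection_of_mem_of_inner_eq_zero ⟨fun u hu => ?_, ?_⟩ fun w hw => ?_
  · rw [sub_apply, ← sub_sub_sub_cancel_left _ _ x, inner_sub_right,
      inner_eq_zero_symm.1 (Submodule.starProjection_inner_eq_zero x u hu),
      inner_eq_zero_symm.1 (Submodule.starProjection_inner_eq_zero x u (h hu)), sub_zero]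
  · exact sub_mem (Submodule.starProjection_apply_mem _ _)
      (h (Submodule.starProjection_apply_mem _ _))
  · rw [sub_apply, ← sub_add, inner_add_left,
      Submodule.starProjection_inner_eq_zero x w hw.2, zero_add]
    exact hw.1 _ (Submodule.starProjection_apply_mem _ _)

variable {N d : ℕ} {A : Matrix (Fin N) (Fin N) ℝ} {B : Matrix (Fin N) (Fin d) ℝ}

theorem toEuclideanLin_pow_mul (k : ℕ) (θ : RSp d) :
    Matrix.toEuclideanLin (A ^ k * B) θ
      = (Matrix.toEuclideanCLM (𝕜 := ℝ) A ^ k) (Matrix.toEuclideanLin B θ) := by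
  rw [← map_pow, ← ContinuousLinearMap.coe_coe, Matrix.coe_toEuclideanCLM_eq_toEuclideanLin]
  simp [Matrix.toLpLin_apply]

theorem toEuclideanLin_mem_flagSpace {k h : ℕ} (hk : k < h) (θ : RSp d) :
    Matrix.toEuclideanLin (A ^ k * B) θ ∈ flagSpace A B h :=
  le_iSup (fun k : Fin h => LinearMap.range (Matrix.toEuclideanLin (A ^ (k : ℕ) * B))) ⟨k, hk⟩
    ⟨θ, rfl⟩

theorem flagSpace_le {h : ℕ} {S : Submodule ℝ (RSp N)}
    (hS : ∀ k < h, ∀ θ, Matrix.toEuclideanLin (A ^ k * B) θ ∈ S) : flagSpace A B h ≤ S :=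
  iSup_le fun k => by
    rintro _ ⟨θ, rfl⟩
    exact hS k k.2 θ

theorem flagSpace_mono : Monotone (flagSpace A B) := fun _ _ hk =>
  flagSpace_le fun _ hi θ => toEuclideanLin_mem_flagSpace (hi.trans_le hk) θ

theorem flagSpace_zero : flagSpace A B 0 = ⊥ := by simp [flagSpace]

theorem flagSpace_eq_top {r : ℕ} (hr : (kalmanMatrix A B r).rank = N) : flagSpace A B r = ⊤ := by
  have hsurj : LinearMap.range (kalmanMatrix A B r).mulVecLin = ⊤ :=
    Submodule.eq_top_of_finrank_eq (by rw [← Matrix.rank, hr, Module.finrank_fin_fun])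
  refine eq_top_iff.2 fun x _ => ?_
  obtain ⟨c, hc⟩ := LinearMap.range_eq_top.1 hsurj x.ofLp
  have hx : x = ∑ k : Fin r, Matrix.toEuclideanLin (A ^ (k : ℕ) * B)
      (WithLp.toLp 2 fun j => c (k, j)) := by
    ext i
    simp only [← hc, Matrix.mulVecLin_apply, Matrix.mulVec, dotProduct, kalmanMatrix,
      Matrix.of_apply, Fintype.sum_prod_type, WithLp.ofLp_sum, Finset.sum_apply,
      Matrix.toLpLin_apply]
  rw [hx]
  exact Submodule.sum_mem _ fun k _ => toEuclideanLin_mem_flagSpace k.2 _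

theorem flagSpace_kalmanIndex (hK : (kalmanMatrix A B N).rank = N) :
    flagSpace A B (kalmanIndex A B) = ⊤ :=
  flagSpace_eq_top (Nat.sInf_mem (s := {r : ℕ | (kalmanMatrix A B r).rank = N}) ⟨N, hK⟩)

theorem flagProj_mem (h : ℕ) (x : RSp N) :
    flagProj A B h x ∈ (flagSpace A B h)ᗮ ⊓ flagSpace A B (h + 1) :=
  Submodule.starProjection_apply_mem _ _

theorem flagProj_apply_of_mem {h : ℕ} {x : RSp N} (hx : x ∈ flagSpace A B h) :
    flagProj A B h x = 0 := by
  refine (Submodule.starProjection_apply_eq_zero_iff _).2 fun w hw => ?_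
  rw [real_inner_comm]
  exact hw.1 x hx

theorem flagProj_toEuclideanLin {k h : ℕ} (hk : k < h) (θ : RSp d) :
    flagProj A B h (Matrix.toEuclideanLin (A ^ k * B) θ) = 0 :=
  flagProj_apply_of_mem (toEuclideanLin_mem_flagSpace hk θ)

theorem flagProj_apply_self (h : ℕ) (x : RSp N) :
    flagProj A B h (flagProj A B h x) = flagProj A B h x :=
  Submodule.starProjection_eq_self_iff.2 (flagProj_mem h x)

theorem flagProj_apply_of_ne {h k : ℕ} (hk : h ≠ k) (x : RSp N) :
    flagProj A B h (flagProj A B k x) = 0 := by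
  rcases hk.lt_or_gt with hlt | hlt
  · refine (Submodule.starProjection_apply_eq_zero_iff _).2 fun w hw => ?_
    exact (flagProj_mem k x).1 w (flagSpace_mono hlt hw.2)
  · exact flagProj_apply_of_mem (flagSpace_mono hlt (flagProj_mem k x).2)

theorem sum_flagProj (m : ℕ) :
    ∑ h ∈ Finset.range m, flagProj A B h = (flagSpace A B m).starProjection := by
  have hlayer : ∀ h, flagProj A B h =
      (flagSpace A B (h + 1)).starProjection - (flagSpace A B h).starProjection :=
    fun h => starProjection_orthogonal_inf (flagSpace_mono h.le_succ)
  simp only [hlayer]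
  rw [Finset.sum_range_sub fun h => (flagSpace A B h).starProjection]
  simp [flagSpace_zero]

theorem norm_flagProj_le (h : ℕ) : ‖flagProj A B h‖ ≤ 1 := Submodule.starProjection_norm_le _

theorem inner_flagProj (h : ℕ) (x y : RSp N) :
    inner ℝ (flagProj A B h x) y = inner ℝ x (flagProj A B h y) :=
  Submodule.inner_starProjection_left_eq_right _ _ _

theorem flagProj_eq_zero_of_inner {k : ℕ} {x : RSp N}
    (h : ∀ θ, inner ℝ (Matrix.toEuclideanLin (A ^ k * B) θ) (flagProj A B k x) = 0) :
    flagProj A B k x = 0 := by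
  have hle : flagSpace A B (k + 1) ≤ (ℝ ∙ flagProj A B k x)ᗮ := flagSpace_le fun i hi θ => by
    rw [Submodule.mem_orthogonal_singleton_iff_inner_left]
    rcases (Nat.lt_succ_iff_lt_or_eq.1 hi) with hik | rfl
    · exact (flagProj_mem k x).1 _ (toEuclideanLin_mem_flagSpace hik θ)
    · exact h θ
  exact inner_self_eq_zero.1
    (Submodule.mem_orthogonal_singleton_iff_inner_left.1 (hle (flagProj_mem k x).2))

theorem dilation_apply (t : ℝ) (x : RSp N) :
    dilation A B t x = ∑ h ∈ Finset.range (kalmanIndex A B), t ^ h • flagProj A B h x := by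
  simp [dilation]

theorem norm_dilation_le {t : ℝ} (ht : |t| ≤ 1) : ‖dilation A B t‖ ≤ kalmanIndex A B := by
  have hterm : ∀ h ∈ Finset.range (kalmanIndex A B), ‖t ^ h • flagProj A B h‖ ≤ 1 := fun h _ => by
    rw [norm_smul, norm_pow, Real.norm_eq_abs]
    exact mul_le_one₀ (pow_le_one₀ (abs_nonneg _) ht) (norm_nonneg _) (norm_flagProj_le h)
  simpa [dilation] using norm_sum_le_of_le _ hterm

theorem dilation_mul (s t : ℝ) : dilation A B s * dilation A B t = dilation A B (s * t) := by
  ext1 x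
  rw [mul_apply_eq_comp, dilation_apply s, dilation_apply (s * t)]
  refine Finset.sum_congr rfl fun h hh => ?_
  rw [dilation_apply, map_sum, Finset.sum_eq_single_of_mem h hh fun k _ hk => by
    rw [map_smul, flagProj_apply_of_ne hk.symm, smul_zero]]
  rw [map_smul, flagProj_apply_self, smul_smul, mul_pow]

theorem dilation_one (hK : (kalmanMatrix A B N).rank = N) : dilation A B 1 = 1 := by
  simp only [dilation, one_pow, one_smul]
  rw [sum_flagProj, flagSpace_kalmanIndex hK, Submodule.starProjection_top']

theorem ringInverse_dilation (hK : (kalmanMatrix A B N).rank = N) {t : ℝ} (ht : t ≠ 0) :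
    Ring.inverse (dilation A B t) = dilation A B t⁻¹ :=
  Ring.inverse_unit ⟨dilation A B t, dilation A B t⁻¹,
    by rw [dilation_mul, mul_inv_cancel₀ ht, dilation_one hK],
    by rw [dilation_mul, inv_mul_cancel₀ ht, dilation_one hK]⟩

theorem dilation_apply_range (hK : (kalmanMatrix A B N).rank = N) (t : ℝ) (θ : RSp d) :
    dilation A B t (Matrix.toEuclideanLin B θ) = Matrix.toEuclideanLin B θ := by
  have hone : dilation A B 1 (Matrix.toEuclideanLin B θ) = Matrix.toEuclideanLin B θ := by
    rw [dilation_one hK, one_apply_eq_self]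
  refine Eq.trans ?_ hone
  rw [dilation_apply, dilation_apply]
  refine Finset.sum_congr rfl fun h _ => ?_
  rcases h.eq_zero_or_pos with rfl | hh
  · simp only [pow_zero]
  · have hzero : flagProj A B h (Matrix.toEuclideanLin B θ) = 0 := by
      simpa only [pow_zero, Matrix.one_mul] using flagProj_toEuclideanLin (A := A) (B := B) hh θ
    rw [hzero, smul_zero, smul_zero]

theorem norm_le_mul_norm_dilation_inv (hK : (kalmanMatrix A B N).rank = N) {t : ℝ}
    (ht : t ∈ Ioc (0 : ℝ) 1) (x : RSp N) :
    ‖x‖ ≤ kalmanIndex A B * ‖dilation A B t⁻¹ x‖ := by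
  have hx : dilation A B t (dilation A B t⁻¹ x) = x := by
    rw [← mul_apply_eq_comp, dilation_mul, mul_inv_cancel₀ ht.1.ne', dilation_one hK,
      one_apply_eq_self]
  have ht1 : |t| ≤ 1 := abs_le.2 ⟨by linarith [ht.1], ht.2⟩
  calc ‖x‖ = ‖dilation A B t (dilation A B t⁻¹ x)‖ := by rw [hx]
    _ ≤ kalmanIndex A B * ‖dilation A B t⁻¹ x‖ :=
      (dilation A B t).le_of_opNorm_le (norm_dilation_le ht1) _

theorem transported_eq_dilation_exp (hK : (kalmanMatrix A B N).rank = N) {t : ℝ} (ht : t ≠ 0)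
    (s : ℝ) (θ : RSp d) :
    transported A B t s θ = dilation A B t⁻¹
      (NormedSpace.exp ((s * t) • Matrix.toEuclideanCLM (𝕜 := ℝ) A)
        (Matrix.toEuclideanLin B θ)) := by
  rcases eq_or_ne s 0 with rfl | hs
  · have hzero : (0 : ℝ) • Matrix.toEuclideanCLM (𝕜 := ℝ) A = 0 :=
      zero_smul ℝ (_ : RSp N →L[ℝ] RSp N)
    simp [transported, resolventMap, dilation_apply_range hK, hzero]
  · rw [transported, resolventMap, if_neg (mul_ne_zero hs ht), ringInverse_dilation hK
      (mul_ne_zero hs ht), mul_apply_eq_comp, mul_apply_eq_comp,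
      dilation_apply_range hK, ← mul_apply_eq_comp, dilation_mul, mul_inv_rev,
      mul_comm t⁻¹, mul_inv_cancel_left₀ hs]

end Flag

section UniformKalman

open Filter Topology

theorem eq_zero_of_frequently_eq_zero_of_hasSum {𝕜 E : Type*} [NontriviallyNormedField 𝕜]
    [NormedAddCommGroup E] [NormedSpace 𝕜 E] {a : ℕ → E} {f : 𝕜 → E}
    (hf : ∀ᶠ s in 𝓝 0, HasSum (fun k => s ^ k • a k) (f s)) (h0 : ∃ᶠ s in 𝓝[≠] 0, f s = 0) :
    a = 0 := by
  let p : FormalMultilinearSeries 𝕜 𝕜 E := fun k =>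
    ContinuousMultilinearMap.mkPiRing 𝕜 (Fin k) (a k)
  have hp : HasFPowerSeriesAt f p 0 := by
    rw [hasFPowerSeriesAt_iff]
    simpa [FormalMultilinearSeries.coeff, p] using hf
  have hzero := hp.eq_zero_of_eventually (hp.analyticAt.frequently_zero_iff_eventually_zero.1 h0)
  ext k
  simpa [p] using DFunLike.congr_fun (congrFun hzero k) 1

theorem hasSum_exp_smul_apply {E : Type*} [NormedAddCommGroup E] [NormedSpace ℝ E]
    [CompleteSpace E] (c : ℝ) (T : E →L[ℝ] E) (x : E) :
    HasSum (fun k : ℕ => (c ^ k / k.factorial) • (T ^ k) x) (NormedSpace.exp (c • T) x) := by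
  simpa [smul_pow, smul_smul, div_eq_inv_mul] using
    (NormedSpace.exp_series_hasSum_exp' (𝕂 := ℝ) (c • T)).mapL (ContinuousLinearMap.apply ℝ E x)

theorem exists_pos_mul_norm_sq_le {X E : Type*} [TopologicalSpace X] [NormedAddCommGroup E]
    [NormedSpace ℝ E] [ProperSpace E] {K : Set X} (hK : IsCompact K) {q : X → E → ℝ}
    (hq : Continuous (Function.uncurry q)) (hhom : ∀ x r v, q x (r • v) = r ^ 2 * q x v)
    (hpos : ∀ x ∈ K, ∀ v ≠ 0, 0 < q x v) :
    ∃ c : ℝ, 0 < c ∧ ∀ x ∈ K, ∀ v, c * ‖v‖ ^ 2 ≤ q x v := by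
  have hmem : ∀ v ∈ Metric.sphere (0 : E) 1, v ≠ 0 := fun v hv =>
    ne_zero_of_mem_unit_sphere (⟨v, hv⟩ : Metric.sphere (0 : E) 1)
  obtain ⟨c, hc, hcq⟩ := (hK.prod (isCompact_sphere (0 : E) 1)).exists_forall_le' hq.continuousOn
    (a := 0) fun p hp => hpos p.1 hp.1 p.2 (hmem p.2 hp.2)
  refine ⟨c, hc, fun x hx v => ?_⟩
  rcases eq_or_ne v 0 with rfl | hv
  · have hzero : q x 0 = 0 := by simpa using hhom x 0 0
    simp [hzero]
  · have hunit : ‖v‖⁻¹ • v ∈ Metric.sphere (0 : E) 1 := by simp [norm_smul, hv]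
    have hle : c ≤ q x (‖v‖⁻¹ • v) := hcq (x, ‖v‖⁻¹ • v) ⟨hx, hunit⟩
    rwa [hhom, inv_pow, inv_mul_eq_div, le_div_iff₀ (by positivity)] at hle

variable {N d : ℕ} (A : Matrix (Fin N) (Fin N) ℝ) (B : Matrix (Fin N) (Fin d) ℝ)

/-- The map `∑_{h ≤ k} t^{k-h} E_h A^k B / k!`, the coefficient of `s^k` in `𝕄_s R_{st} B`. The
terms with `h > k`, which would carry negative powers of `t`, are left out since they vanish:
`E_h` is zero on the image of `A^k B`. -/
noncomputable def flagCoeff (t : ℝ) (k : ℕ) : RSp d →L[ℝ] RSp N :=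
  (k.factorial : ℝ)⁻¹ • ∑ h ∈ Finset.range (kalmanIndex A B) with h ≤ k,
    t ^ (k - h) • (flagProj A B h ∘L (Matrix.toEuclideanLin (A ^ k * B)).toContinuousLinearMap)

/-- The power series `∑_k s^k ∑_{h ≤ k} t^{k-h} E_h A^k B / k!`, which extends `𝕄_s R_{st} B`
continuously to `t = 0`. -/
noncomputable def flagSeries (t s : ℝ) : RSp d →L[ℝ] RSp N := ∑' k, s ^ k • flagCoeff A B t k

/-- The `k`-th term of a series dominating `flagSeries A B t s` for `|t|, |s| ≤ R`, where
`1 ≤ R`. -/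
noncomputable def flagBound (R : ℝ) (k : ℕ) : ℝ :=
  (kalmanIndex A B * ‖(Matrix.toEuclideanLin B).toContinuousLinearMap‖) *
    ((R ^ 2 * ‖(Matrix.toEuclideanCLM (𝕜 := ℝ) A : RSp N →L[ℝ] RSp N)‖) ^ k / k.factorial)

variable {A B}

theorem summable_flagBound (R : ℝ) : Summable (flagBound A B R) :=
  (Real.summable_pow_div_factorial _).mul_left _

theorem norm_toEuclideanLin_pow_mul_le (k : ℕ) :
    ‖(Matrix.toEuclideanLin (A ^ k * B)).toContinuousLinearMap‖ ≤
      ‖(Matrix.toEuclideanCLM (𝕜 := ℝ) A : RSp N →L[ℝ] RSp N)‖ ^ k *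
        ‖(Matrix.toEuclideanLin B).toContinuousLinearMap‖ := by
  induction k with
  | zero => simp
  | succ k ih =>
    refine ContinuousLinearMap.opNorm_le_bound _ (by positivity) fun θ => ?_
    rw [LinearMap.coe_toContinuousLinearMap', toEuclideanLin_pow_mul, pow_succ',
      mul_apply_eq_comp, ← toEuclideanLin_pow_mul, pow_succ', mul_assoc, mul_assoc]
    refine (ContinuousLinearMap.le_opNorm _ _).trans ?_
    gcongr
    exact (ContinuousLinearMap.le_of_opNorm_le _ ih θ).trans_eq (mul_assoc _ _ _)

theorem norm_pow_smul_flagCoeff_le {R t s : ℝ} (hR : 1 ≤ R) (ht : |t| ≤ R) (hs : |s| ≤ R)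
    (k : ℕ) : ‖s ^ k • flagCoeff A B t k‖ ≤ flagBound A B R k := by
  set a := ‖(Matrix.toEuclideanCLM (𝕜 := ℝ) A : RSp N →L[ℝ] RSp N)‖
  set b := ‖(Matrix.toEuclideanLin B).toContinuousLinearMap‖
  have hterm : ∀ h ∈ (Finset.range (kalmanIndex A B)).filter (· ≤ k),
      ‖t ^ (k - h) • (flagProj A B h ∘L
        (Matrix.toEuclideanLin (A ^ k * B)).toContinuousLinearMap)‖ ≤ R ^ k * (a ^ k * b) := by
    intro h _
    rw [norm_smul, norm_pow, Real.norm_eq_abs]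
    refine mul_le_mul ((pow_le_pow_left₀ (abs_nonneg _) ht _).trans
      (pow_le_pow_right₀ hR (Nat.sub_le k h))) ?_ (norm_nonneg _) (by positivity)
    refine (ContinuousLinearMap.opNorm_comp_le _ _).trans ?_
    exact (mul_le_of_le_one_left (norm_nonneg _) (norm_flagProj_le h)).trans
      (norm_toEuclideanLin_pow_mul_le k)
  have hcard : ((Finset.range (kalmanIndex A B)).filter (· ≤ k)).card ≤ kalmanIndex A B :=
    (Finset.card_filter_le _ _).trans_eq (Finset.card_range _)
  calc ‖s ^ k • flagCoeff A B t k‖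
      ≤ R ^ k * ((k.factorial : ℝ)⁻¹ * (kalmanIndex A B * (R ^ k * (a ^ k * b)))) := by
        rw [norm_smul, norm_pow, Real.norm_eq_abs, flagCoeff, norm_smul, norm_inv,
          Real.norm_natCast]
        gcongr
        refine (norm_sum_le_of_le _ hterm).trans ?_
        rw [Finset.sum_const, nsmul_eq_mul]
        gcongr
    _ = flagBound A B R k := by rw [flagBound]; ring

theorem hasSum_flagSeries (t s : ℝ) :
    HasSum (fun k => s ^ k • flagCoeff A B t k) (flagSeries A B t s) :=
  (Summable.of_norm_bounded (summable_flagBound (1 + |t| + |s|)) <| norm_pow_smul_flagCoeff_le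
    (by linarith [abs_nonneg t, abs_nonneg s]) (by linarith [abs_nonneg s])
    (by linarith [abs_nonneg t])).hasSum

theorem continuous_flagSeries : Continuous fun p : ℝ × ℝ => flagSeries A B p.1 p.2 := by
  refine continuous_iff_continuousAt.2 fun p => ?_
  have hball : ContinuousOn (fun p : ℝ × ℝ => flagSeries A B p.1 p.2)
      (Metric.ball 0 (1 + ‖p‖)) := by
    refine continuousOn_tsum (fun k => Continuous.continuousOn ?_)
      (summable_flagBound (A := A) (B := B) (1 + ‖p‖)) fun k r hr => ?_
    · unfold flagCoeff
      fun_prop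
    · have hr' : ‖r‖ ≤ 1 + ‖p‖ := (mem_ball_zero_iff.1 hr).le
      exact norm_pow_smul_flagCoeff_le (by linarith [norm_nonneg p]) ((norm_fst_le r).trans hr')
        ((norm_snd_le r).trans hr') k
  exact hball.continuousAt (Metric.isOpen_ball.mem_nhds (by simp))

theorem transported_eq_flagSeries (hK : (kalmanMatrix A B N).rank = N) {t : ℝ} (ht : t ≠ 0)
    (s : ℝ) (θ : RSp d) : transported A B t s θ = flagSeries A B t s θ := by
  have hexp := (hasSum_exp_smul_apply (s * t) (Matrix.toEuclideanCLM (𝕜 := ℝ) A)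
    (Matrix.toEuclideanLin B θ)).mapL (dilation A B t⁻¹)
  have hseries := (hasSum_flagSeries (A := A) (B := B) t s).mapL
    (ContinuousLinearMap.apply ℝ (RSp N) θ)
  rw [transported_eq_dilation_exp hK ht]
  refine hexp.unique (hseries.congr_fun fun k => ?_)
  simp only [ContinuousLinearMap.apply_apply, _root_.smul_apply, map_smul, flagCoeff,
    dilation_apply, _root_.sum_apply, ContinuousLinearMap.comp_apply,
    LinearMap.coe_toContinuousLinearMap', Finset.smul_sum, smul_smul, ← toEuclideanLin_pow_mul]
  symm
  refine Finset.sum_subset_zero_on_sdiff (Finset.filter_subset _ _) (fun h hh => ?_) fun h hh => ?_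
  · have hk : k < h := by
      rw [Finset.mem_sdiff, Finset.mem_filter] at hh
      exact not_le.1 fun hle => hh.2 ⟨hh.1, hle⟩
    rw [flagProj_toEuclideanLin hk θ, smul_zero]
  · obtain ⟨j, rfl⟩ := Nat.exists_eq_add_of_le (Finset.mem_filter.1 hh).2
    congr 1
    rw [Nat.add_sub_cancel_left, mul_pow, pow_add t, inv_pow]
    field_simp

theorem eq_zero_of_inner_flagCoeff (hK : (kalmanMatrix A B N).rank = N) {t : ℝ} {ω : RSp N}
    (h : ∀ k θ, inner ℝ (flagCoeff A B t k θ) ω = 0) : ω = 0 := by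
  have hproj : ∀ k < kalmanIndex A B, flagProj A B k ω = 0 := by
    intro k
    induction k using Nat.strong_induction_on with
    | _ k ih =>
    intro hk
    refine flagProj_eq_zero_of_inner fun θ => ?_
    have hsum := h k θ
    simp only [flagCoeff, _root_.smul_apply, _root_.sum_apply, inner_smul_left, sum_inner,
      ContinuousLinearMap.comp_apply, LinearMap.coe_toContinuousLinearMap', inner_flagProj,
      conj_trivial] at hsum
    have hsum' := (mul_eq_zero.1 hsum).resolve_left (by positivity)
    rw [Finset.sum_eq_single_of_mem k (by simp [hk])] at hsum'
    · simpa using hsum'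
    · intro j hj hjk
      rw [Finset.mem_filter, Finset.mem_range] at hj
      rw [ih j (lt_of_le_of_ne hj.2 hjk) hj.1, inner_zero_right, mul_zero]
  have hω : ω = ∑ k ∈ Finset.range (kalmanIndex A B), flagProj A B k ω := by
    rw [← _root_.sum_apply, sum_flagProj, flagSpace_kalmanIndex hK,
      Submodule.starProjection_top', one_apply_eq_self]
  rw [hω]
  exact Finset.sum_eq_zero fun k hk => hproj k (Finset.mem_range.1 hk)

open ContinuousLinearMap in
theorem exists_adjoint_flagSeries_ne_zero (hK : (kalmanMatrix A B N).rank = N) (t : ℝ)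
    {ω : RSp N} (hω : ω ≠ 0) : ∃ s ∈ Icc (0 : ℝ) 1, adjoint (flagSeries A B t s) ω ≠ 0 := by
  by_contra! hvanish
  refine hω (eq_zero_of_inner_flagCoeff (t := t) hK fun k θ => ?_)
  have hsum : ∀ s, HasSum (fun k => s ^ k • (inner ℝ (flagCoeff A B t k θ) ω))
      (inner ℝ (flagSeries A B t s θ) ω) := fun s => by
    simpa [inner_smul_left, real_inner_comm] using ((hasSum_flagSeries (A := A) (B := B) t s).mapL
      (apply ℝ (RSp N) θ)).mapL (innerSL ℝ ω)
  have hfreq : ∃ᶠ s in 𝓝[≠] (0 : ℝ), inner ℝ (flagSeries A B t s θ) ω = 0 := by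
    have hIoc : ∀ᶠ s in 𝓝[>] (0 : ℝ), inner ℝ (flagSeries A B t s θ) ω = 0 := by
      filter_upwards [Ioc_mem_nhdsGT zero_lt_one] with s hs
      rw [← adjoint_inner_right, hvanish s ⟨hs.1.le, hs.2⟩, inner_zero_right]
    exact hIoc.frequently.filter_mono (nhdsGT_le_nhdsNE 0)
  exact congrFun (eq_zero_of_frequently_eq_zero_of_hasSum (Eventually.of_forall hsum) hfreq) k

open ContinuousLinearMap in
theorem exists_le_integral_adjoint_flagSeries (hK : (kalmanMatrix A B N).rank = N) :
    ∃ c : ℝ, 0 < c ∧ ∀ t ∈ Icc (0 : ℝ) 1, ∀ ω : RSp N,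
      c * ‖ω‖ ^ 2 ≤ ∫ s in (0 : ℝ)..1, ‖adjoint (flagSeries A B t s) ω‖ ^ 2 := by
  have hcont : Continuous fun p : (ℝ × RSp N) × ℝ =>
      ‖adjoint (flagSeries A B p.1.1 p.2) p.1.2‖ ^ 2 := by
    have hF : Continuous fun p : (ℝ × RSp N) × ℝ => adjoint (flagSeries A B p.1.1 p.2) :=
      (LinearIsometryEquiv.continuous _).comp
        (continuous_flagSeries.comp (f := fun p : (ℝ × RSp N) × ℝ => (p.1.1, p.2)) (by fun_prop))
    fun_prop
  refine exists_pos_mul_norm_sq_le isCompact_Icc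
    (q := fun t ω => ∫ s in (0 : ℝ)..1, ‖adjoint (flagSeries A B t s) ω‖ ^ 2)
    (intervalIntegral.continuous_parametric_intervalIntegral_of_continuous' hcont 0 1)
    (fun t r ω => ?_) fun t _ ω hω => ?_
  · simp only [map_smul, norm_smul, mul_pow, intervalIntegral.integral_const_mul,
      Real.norm_eq_abs, sq_abs]
  · obtain ⟨s, hs, hne⟩ := exists_adjoint_flagSeries_ne_zero hK t hω
    exact intervalIntegral.integral_pos zero_lt_one
      (hcont.comp (f := fun s => ((t, ω), s)) (by fun_prop)).continuousOn
      (fun _ _ => by positivity) ⟨s, hs, by positivity⟩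

end UniformKalman

section SphericalPart

open scoped NNReal

variable {N d : ℕ} {A : Matrix (Fin N) (Fin N) ℝ} {B : Matrix (Fin N) (Fin d) ℝ}

theorem exists_le_norm_exp_smul_apply {E F : Type*} [NormedAddCommGroup E] [NormedSpace ℝ E]
    [CompleteSpace E] [NormedAddCommGroup F] [NormedSpace ℝ F] [ProperSpace F] (T : E →L[ℝ] E)
    {S : F →L[ℝ] E} (hS : Function.Injective S) :
    ∃ c : ℝ, 0 < c ∧ ∀ r ∈ Icc (0 : ℝ) 1, ∀ v, c * ‖v‖ ≤ ‖NormedSpace.exp (r • T) (S v)‖ := by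
  have : NormedAlgebra ℚ (E →L[ℝ] E) := NormedAlgebra.restrictScalars ℚ ℝ _
  have hinj (r : ℝ) : Function.Injective (NormedSpace.exp (r • T) : E →L[ℝ] E) :=
    (ContinuousLinearMap.isUnit_iff_bijective.1 (NormedSpace.isUnit_exp (r • T))).injective
  have hexp : Continuous fun r : ℝ => NormedSpace.exp (r • T) :=
    NormedSpace.exp_continuous.comp (by fun_prop)
  have hcont : Continuous fun p : ℝ × F => ‖NormedSpace.exp (p.1 • T) (S p.2)‖ ^ 2 :=
    (((hexp.comp continuous_fst).clm_apply (S.continuous.comp continuous_snd)).norm).pow 2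
  obtain ⟨c, hc, hle⟩ := exists_pos_mul_norm_sq_le (isCompact_Icc (a := (0 : ℝ)) (b := 1))
    (q := fun r v => ‖NormedSpace.exp (r • T) (S v)‖ ^ 2) hcont
    (fun r a v => by simp only [map_smul, norm_smul, mul_pow, Real.norm_eq_abs, sq_abs])
    fun r _ v hv => by
      have hne : NormedSpace.exp (r • T) (S v) ≠ 0 := by
        rw [Ne, map_eq_zero_iff _ (hinj r), map_eq_zero_iff S hS]
        exact hv
      positivity
  refine ⟨√c, Real.sqrt_pos.2 hc, fun r hr v => ?_⟩
  rw [← pow_le_pow_iff_left₀ (by positivity) (norm_nonneg _) two_ne_zero, mul_pow,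
    Real.sq_sqrt hc.le]
  exact hle r hr v

theorem toEuclideanLin_injective_of_rank (hB : B.rank = d) :
    Function.Injective (Matrix.toEuclideanLin B) := by
  have hker : LinearMap.ker B.mulVecLin = ⊥ := by
    have hdim := LinearMap.finrank_range_add_finrank_ker B.mulVecLin
    rw [← Matrix.rank, hB, Module.finrank_fin_fun] at hdim
    exact Submodule.finrank_eq_zero.1 (by lia)
  exact fun x y hxy => WithLp.ofLp_injective 2
    (LinearMap.ker_eq_bot.1 hker (congrArg WithLp.ofLp hxy))

theorem exists_le_norm_transported (hB : B.rank = d) (hK : (kalmanMatrix A B N).rank = N) :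
    ∃ c : ℝ, 0 < c ∧ ∀ t ∈ Ioc (0 : ℝ) 1, ∀ s ∈ Icc (0 : ℝ) 1, ∀ θ : RSp d,
      c * ‖θ‖ ≤ ‖transported A B t s θ‖ := by
  obtain ⟨c, hc, hexp⟩ := exists_le_norm_exp_smul_apply (Matrix.toEuclideanCLM (𝕜 := ℝ) A)
    (S := (Matrix.toEuclideanLin B).toContinuousLinearMap) (toEuclideanLin_injective_of_rank hB)
  refine ⟨(kalmanIndex A B + 1 : ℝ)⁻¹ * c, by positivity, fun t ht s hs θ => ?_⟩
  rw [mul_assoc, inv_mul_le_iff₀ (by positivity), transported_eq_dilation_exp hK ht.1.ne']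
  calc c * ‖θ‖
      ≤ _ := hexp (s * t) ⟨mul_nonneg hs.1 ht.1.le, mul_le_one₀ hs.2 ht.1.le ht.2⟩ θ
    _ ≤ _ := norm_le_mul_norm_dilation_inv hK ht _
    _ ≤ _ := mul_le_mul_of_nonneg_right (by linarith) (norm_nonneg _)

theorem pos_of_rank_kalmanMatrix (hN : 1 ≤ N) (hK : (kalmanMatrix A B N).rank = N) : 0 < d := by
  rw [Nat.pos_iff_ne_zero]
  rintro rfl
  have hrank := (kalmanMatrix A B N).rank_le_card_width
  rw [hK, Fintype.card_prod, Fintype.card_fin, Fintype.card_fin] at hrank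
  lia

theorem transportedInf_pos (hN : 1 ≤ N) (hB : B.rank = d)
    (hK : (kalmanMatrix A B N).rank = N) : 0 < transportedInf A B := by
  obtain ⟨c, hc, hle⟩ := exists_le_norm_transported hB hK
  refine hc.trans_le (le_csInf ?_ ?_)
  · have : Nonempty (Fin d) := ⟨⟨0, pos_of_rank_kalmanMatrix hN hK⟩⟩
    obtain ⟨θ, hθ⟩ := (NormedSpace.sphere_nonempty (x := (0 : RSp d))).2 zero_le_one
    exact ⟨_, 1 / 2, by norm_num, 1, by norm_num, θ, hθ, rfl⟩
  · rintro _ ⟨s, hs, t, ht, θ, hθ, rfl⟩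
    simpa [mem_sphere_zero_iff_norm.1 hθ] using hle t ht s ⟨hs.1.le, hs.2.le⟩ θ

theorem IsNondegSpherical.ae_norm_eq_one {α : ℝ} {μ : Measure (RSp d)}
    (hμ : IsNondegSpherical α μ) : ∀ᵐ θ ∂μ, ‖θ‖ = 1 := by
  have hmem : ∀ᵐ θ ∂μ, θ ∈ Metric.sphere (0 : RSp d) 1 := mem_ae_iff.2 hμ.carried
  simpa using hmem

theorem IsNondegSpherical.exists_le_integral_sq {α : ℝ} (hα : α ≠ 0) {μ : Measure (RSp d)}
    (hμ : IsNondegSpherical α μ) :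
    ∃ c : ℝ, 0 < c ∧ ∀ p : RSp d, c * ‖p‖ ^ 2 ≤ ∫ s, (inner ℝ p s) ^ 2 ∂μ := by
  have := hμ.finite
  have hrestrict : μ.restrict (Metric.sphere 0 1) = μ :=
    Measure.restrict_eq_self_of_ae_mem (mem_ae_iff.2 hμ.carried)
  have hint (p : RSp d) : Integrable (fun s => (inner ℝ p s) ^ 2) μ := by
    refine Integrable.of_bound (C := ‖p‖ ^ 2) (by fun_prop) ?_
    filter_upwards [hμ.ae_norm_eq_one] with s hs
    rw [norm_pow]
    gcongr
    simpa [hs] using norm_inner_le_norm (𝕜 := ℝ) p s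
  have hcont : Continuous fun p : RSp d => ∫ s, (inner ℝ p s) ^ 2 ∂μ := by
    rw [← hrestrict]
    exact continuous_parametric_integral_of_continuous
      (f := fun p s : RSp d => (inner ℝ p s) ^ 2) (by fun_prop) (isCompact_sphere 0 1)
  obtain ⟨c, hc, hle⟩ := exists_pos_mul_norm_sq_le (isCompact_singleton (x := ()))
    (q := fun _ (p : RSp d) => ∫ s, (inner ℝ p s) ^ 2 ∂μ) (hcont.comp continuous_snd)
    (fun _ r p => by simp only [real_inner_smul_left, mul_pow, integral_const_mul])
    fun _ _ p hp => by
      refine (integral_nonneg fun s => sq_nonneg _).lt_of_ne' fun hzero => ?_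
      obtain ⟨η, hη, hnondeg⟩ := hμ.nondeg
      have hvanish : ∀ᵐ s ∂μ, |inner ℝ p s| ^ α = 0 := by
        filter_upwards [(integral_eq_zero_iff_of_nonneg (fun s => sq_nonneg _) (hint p)).1 hzero]
          with s hs
        rw [pow_eq_zero_iff two_ne_zero |>.1 hs, abs_zero, Real.zero_rpow hα]
      have hlower := (hnondeg p).1
      rw [integral_congr_ae hvanish, integral_zero] at hlower
      have : 0 < η⁻¹ * ‖p‖ ^ α := by positivity
      linarith
  exact ⟨c, hc, hle () rfl⟩

/-- A measure carried by the unit sphere, of total mass at most `C`, whose quadratic form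
`ω ↦ ∫ ⟨ω, θ⟩² σ(dθ)` is at least `c |ω|²`. -/
structure IsSphericalWithBounds {E : Type*} [NormedAddCommGroup E] [InnerProductSpace ℝ E]
    [MeasurableSpace E] (C : ℝ≥0) (c : ℝ) (σ : Measure E) : Prop where
  measure_univ_le : σ univ ≤ C
  ae_norm_eq_one : ∀ᵐ θ ∂σ, ‖θ‖ = 1
  mul_norm_sq_le : ∀ ω : E, c * ‖ω‖ ^ 2 ≤ ∫ θ, (inner ℝ ω θ) ^ 2 ∂σ

/-- The spherical part of the stable law obtained by transporting jumps along the vectors `V x`: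
the image of `|V|^α S` under `x ↦ V x / |V x|`. -/
noncomputable def angularMeasure {X E : Type*} [MeasurableSpace X] [NormedAddCommGroup E]
    [NormedSpace ℝ E] [MeasurableSpace E] (α : ℝ) (S : Measure X) (V : X → E) : Measure E :=
  (S.withDensity fun x => ENNReal.ofReal (‖V x‖ ^ α)).map fun x => ‖V x‖⁻¹ • V x

section AngularMeasure

variable {X E : Type*} [MeasurableSpace X] [NormedAddCommGroup E] [InnerProductSpace ℝ E]
  [MeasurableSpace E] [BorelSpace E] [SecondCountableTopology E] {α : ℝ} {S : Measure X}
  {V : X → E}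

theorem angularMeasure_univ_le (hα : 0 ≤ α) (hV : Measurable V) {R : ℝ≥0}
    (hle : ∀ᵐ x ∂S, ‖V x‖ ≤ R) : angularMeasure α S V univ ≤ (R ^ α : ℝ≥0) * S univ := by
  rw [angularMeasure, Measure.map_apply (by fun_prop) .univ, preimage_univ,
    withDensity_apply _ .univ, Measure.restrict_univ, ← lintegral_const]
  refine lintegral_mono_ae ?_
  filter_upwards [hle] with x hx
  exact ENNReal.ofReal_le_of_le_toReal
    (by simpa using Real.rpow_le_rpow (norm_nonneg _) hx hα)

theorem ae_angularMeasure_norm_eq_one (hV : Measurable V) (hne : ∀ᵐ x ∂S, V x ≠ 0) :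
    ∀ᵐ θ ∂angularMeasure α S V, ‖θ‖ = 1 := by
  rw [angularMeasure, ae_map_iff (by fun_prop) (measurableSet_eq_fun (by fun_prop) (by fun_prop))]
  refine (withDensity_absolutelyContinuous S _).ae_le ?_
  filter_upwards [hne] with x hx
  simp [norm_smul, hx]

theorem integral_inner_sq_angularMeasure (hV : Measurable V) (hne : ∀ᵐ x ∂S, V x ≠ 0) (ω : E) :
    ∫ θ, (inner ℝ ω θ) ^ 2 ∂angularMeasure α S V =
      ∫ x, ‖V x‖ ^ (α - 2) * (inner ℝ ω (V x)) ^ 2 ∂S := by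
  rw [angularMeasure, integral_map (by fun_prop) (by fun_prop),
    integral_withDensity_eq_integral_toReal_smul (by fun_prop) (by simp)]
  refine integral_congr_ae ?_
  filter_upwards [hne] with x hx
  have hpos : 0 < ‖V x‖ := norm_pos_iff.2 hx
  rw [ENNReal.toReal_ofReal (by positivity), smul_eq_mul, inner_smul_right, mul_pow,
    Real.rpow_sub hpos, Real.rpow_two, inv_pow, div_eq_mul_inv, mul_assoc]

theorem isSphericalWithBounds_angularMeasure [IsFiniteMeasure S] (hα₀ : 0 ≤ α) (hα₂ : α ≤ 2)
    (hV : Measurable V) {R : ℝ≥0} (hne : ∀ᵐ x ∂S, V x ≠ 0) (hle : ∀ᵐ x ∂S, ‖V x‖ ≤ R)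
    {c : ℝ} (hc : ∀ ω, c * ‖ω‖ ^ 2 ≤ ∫ x, (inner ℝ ω (V x)) ^ 2 ∂S) :
    IsSphericalWithBounds (R ^ α * (S univ).toNNReal) ((R : ℝ) ^ (α - 2) * c)
      (angularMeasure α S V) where
  measure_univ_le := by
    simpa using angularMeasure_univ_le hα₀ hV hle
  ae_norm_eq_one := ae_angularMeasure_norm_eq_one hV hne
  mul_norm_sq_le ω := by
    rw [integral_inner_sq_angularMeasure hV hne, mul_assoc]
    refine (mul_le_mul_of_nonneg_left (hc ω) (by positivity)).trans ?_
    rw [← integral_const_mul]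
    refine integral_mono_of_nonneg (.of_forall fun x => by positivity) ?_ ?_
    · refine Integrable.of_bound (C := ‖ω‖ ^ 2 * (R : ℝ) ^ α) (by fun_prop) ?_
      filter_upwards [hne, hle] with x hx hxR
      have hpos : 0 < ‖V x‖ := norm_pos_iff.2 hx
      rw [Real.norm_of_nonneg (by positivity)]
      calc ‖V x‖ ^ (α - 2) * (inner ℝ ω (V x)) ^ 2
          ≤ ‖V x‖ ^ (α - 2) * (‖ω‖ * ‖V x‖) ^ 2 :=
            mul_le_mul_of_nonneg_left (sq_le_sq' (neg_le_of_abs_le (abs_real_inner_le_norm _ _))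
              (real_inner_le_norm _ _)) (by positivity)
        _ = ‖ω‖ ^ 2 * ‖V x‖ ^ α := by rw [Real.rpow_sub hpos, Real.rpow_two]; field_simp
        _ ≤ _ := by gcongr
    · filter_upwards [hne, hle] with x hx hxR
      exact mul_le_mul_of_nonneg_right
        (Real.rpow_le_rpow_of_nonpos (norm_pos_iff.2 hx) hxR (by linarith)) (sq_nonneg _)

end AngularMeasure

theorem continuous_transported (hK : (kalmanMatrix A B N).rank = N) {t : ℝ} (ht : t ≠ 0) :
    Continuous fun p : ℝ × RSp d => transported A B t p.1 p.2 := by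
  simp only [transported_eq_flagSeries hK ht]
  exact (continuous_flagSeries.comp (f := fun p : ℝ × RSp d => (t, p.1)) (by fun_prop)).clm_apply
    continuous_snd

theorem exists_norm_transported_le (hK : (kalmanMatrix A B N).rank = N) :
    ∃ R : ℝ≥0, 0 < R ∧ ∀ t ∈ Ioc (0 : ℝ) 1, ∀ s ∈ Icc (0 : ℝ) 1, ∀ θ : RSp d,
      ‖transported A B t s θ‖ ≤ R * ‖θ‖ := by
  obtain ⟨R, hR⟩ := (isCompact_Icc (a := (0 : ℝ)) (b := 1)).prod (isCompact_Icc (a := (0 : ℝ))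
    (b := 1)) |>.exists_bound_of_continuousOn (continuous_flagSeries (A := A) (B := B)).continuousOn
  refine ⟨R.toNNReal + 1, by positivity, fun t ht s hs θ => ?_⟩
  rw [transported_eq_flagSeries hK ht.1.ne']
  refine (flagSeries A B t s).le_of_opNorm_le ?_ θ
  have hle : R ≤ R.toNNReal := Real.le_coe_toNNReal R
  exact (hR (t, s) ⟨⟨ht.1.le, ht.2⟩, hs⟩).trans (by push_cast; linarith)

theorem exists_le_integral_inner_transported_sq (hK : (kalmanMatrix A B N).rank = N) {α : ℝ}
    (hα : α ≠ 0) {μ : Measure (RSp d)} (hμ : IsNondegSpherical α μ) :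
    ∃ c : ℝ, 0 < c ∧ ∀ t ∈ Ioc (0 : ℝ) 1, ∀ ω : RSp N, c * ‖ω‖ ^ 2 ≤
      ∫ p, (inner ℝ ω (transported A B t p.1 p.2)) ^ 2 ∂(volume.restrict (Icc 0 1)).prod μ := by
  have := hμ.finite
  obtain ⟨a, ha, hA⟩ := exists_le_integral_adjoint_flagSeries (A := A) (B := B) hK
  obtain ⟨b, hb, hB⟩ := hμ.exists_le_integral_sq hα
  obtain ⟨R, -, hR⟩ := exists_norm_transported_le hK
  refine ⟨a * b, by positivity, fun t ht ω => ?_⟩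
  have hcont := continuous_transported hK ht.1.ne'
  have hint : Integrable (fun p => (inner ℝ ω (transported A B t p.1 p.2)) ^ 2)
      ((volume.restrict (Icc 0 1)).prod μ) := by
    refine Integrable.of_bound (C := (‖ω‖ * R) ^ 2) (by fun_prop) ?_
    filter_upwards [Measure.quasiMeasurePreserving_fst.ae (ae_restrict_mem measurableSet_Icc),
      Measure.quasiMeasurePreserving_snd.ae hμ.ae_norm_eq_one] with p hs hθ
    rw [norm_pow]
    refine pow_le_pow_left₀ (norm_nonneg _) ((norm_inner_le_norm _ _).trans ?_) 2
    exact mul_le_mul_of_nonneg_left (by simpa [hθ] using hR t ht p.1 hs p.2) (norm_nonneg _)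
  rw [integral_prod _ hint]
  calc a * b * ‖ω‖ ^ 2
      = b * (a * ‖ω‖ ^ 2) := by ring
    _ ≤ b * ∫ s in (0 : ℝ)..1, ‖ContinuousLinearMap.adjoint (flagSeries A B t s) ω‖ ^ 2 := by
      gcongr
      exact hA t ⟨ht.1.le, ht.2⟩ ω
    _ = ∫ s in Icc (0 : ℝ) 1, b * ‖ContinuousLinearMap.adjoint (flagSeries A B t s) ω‖ ^ 2 := by
      rw [integral_const_mul, integral_Icc_eq_integral_Ioc,
        intervalIntegral.integral_of_le zero_le_one]
    _ ≤ _ := by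
      refine integral_mono_of_nonneg (.of_forall fun s => by positivity) hint.integral_prod_left
        (.of_forall fun s => (hB _).trans_eq ?_)
      simp only [ContinuousLinearMap.adjoint_inner_left, transported_eq_flagSeries hK ht.1.ne']

theorem exists_isSphericalWithBounds (hB : B.rank = d) (hK : (kalmanMatrix A B N).rank = N)
    {α : ℝ} (hα₀ : 0 < α) (hα₂ : α ≤ 2) {μ : Measure (RSp d)} (hμ : IsNondegSpherical α μ) :
    ∃ C : ℝ≥0, ∃ c : ℝ, 0 < c ∧ ∀ t ∈ Ioc (0 : ℝ) 1,
      IsSphericalWithBounds C c (sphericalPart A B α μ t) := by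
  have := hμ.finite
  obtain ⟨a, ha, hlower⟩ := exists_le_norm_transported hB hK
  obtain ⟨R, hR0, hupper⟩ := exists_norm_transported_le hK
  obtain ⟨c, hc, hquad⟩ := exists_le_integral_inner_transported_sq hK hα₀.ne' hμ
  refine ⟨_, _, by positivity, fun t ht => isSphericalWithBounds_angularMeasure
    (S := (volume.restrict (Icc 0 1)).prod μ) (R := R) hα₀.le hα₂
    (continuous_transported hK ht.1.ne').measurable ?_ ?_ (hquad t ht)⟩
  all_goals
    filter_upwards [Measure.quasiMeasurePreserving_fst.ae (ae_restrict_mem measurableSet_Icc),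
      Measure.quasiMeasurePreserving_snd.ae hμ.ae_norm_eq_one] with p hs hθ
  · have hle := hlower t ht p.1 hs p.2
    rw [hθ, mul_one] at hle
    exact norm_pos_iff.1 (ha.trans_le hle)
  · simpa [hθ] using hupper t ht p.1 hs p.2

end SphericalPart

section LevySymbol

open Complex
open scoped ContDiff

section ParametricIntegral

variable {X E F : Type*} [MeasurableSpace X] {κ : Measure X} [NormedAddCommGroup E]
  [NormedSpace ℝ E] [NormedAddCommGroup F] [NormedSpace ℝ F]

theorem hasFDerivAt_integral_of_curryLeft {n : ℕ} {p : X → E → E [×n]→L[ℝ] F}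
    {p' : X → E → E [×n + 1]→L[ℝ] F} (hp : ∀ z x, HasFDerivAt (p z) (p' z x).curryLeft x)
    (hmeas : ∀ x, AEStronglyMeasurable (fun z => p z x) κ) {x : E}
    (hint : Integrable (fun z => p z x) κ) (hmeas' : AEStronglyMeasurable (fun z => p' z x) κ)
    {s : Set E} (hs : s ∈ nhds x) {g : X → ℝ} (hg : Integrable g κ)
    (hle : ∀ᵐ z ∂κ, ∀ y ∈ s, ‖p' z y‖ ≤ g z) :
    HasFDerivAt (fun x => ∫ z, p z x ∂κ) (∫ z, p' z x ∂κ).curryLeft x := by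
  let curry := continuousMultilinearCurryLeftEquiv ℝ (fun _ : Fin (n + 1) => E) F
  have hint' : Integrable (fun z => p' z x) κ :=
    hg.mono' hmeas' (hle.mono fun z hz => hz x (mem_of_mem_nhds hs))
  have hmeasCurry : AEStronglyMeasurable (fun z => (p' z x).curryLeft) κ :=
    curry.continuous.comp_aestronglyMeasurable hmeas'
  have hleCurry : ∀ᵐ z ∂κ, ∀ y ∈ s, ‖(p' z y).curryLeft‖ ≤ g z := by
    filter_upwards [hle] with z hz y hy
    exact (curry.norm_map _).trans_le (hz y hy)
  have hintCurry := Integrable.mono' (β := E →L[ℝ] E [×n]→L[ℝ] F) hg hmeasCurry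
    (hleCurry.mono fun z hz => hz x (mem_of_mem_nhds hs))
  have hderiv := hasFDerivAt_integral_of_dominated_of_fderiv_le hs (.of_forall hmeas) hint
    hmeasCurry hleCurry hg (.of_forall fun z y _ => hp z y)
  refine hderiv.congr_fderiv (ContinuousLinearMap.ext fun v => ?_)
  refine (ContinuousLinearMap.integral_apply hintCurry v).trans
    (ContinuousMultilinearMap.ext fun m => ?_)
  rw [ContinuousMultilinearMap.integral_apply (hintCurry.apply_continuousLinearMap v),
    ContinuousMultilinearMap.curryLeft_apply, ContinuousMultilinearMap.integral_apply hint']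
  rfl

theorem hasFTaylorSeriesUpTo_integral {f : X → E → F} {p : X → E → FormalMultilinearSeries ℝ E F}
    (hp : ∀ z, HasFTaylorSeriesUpTo ∞ (f z) (p z))
    (hmeas : ∀ x n, AEStronglyMeasurable (fun z => p z x n) κ)
    (hbound : ∀ n (R : ℝ), ∃ g : X → ℝ, Integrable g κ ∧
      ∀ᵐ z ∂κ, ∀ x ∈ Metric.ball (0 : E) R, ‖p z x n‖ ≤ g z) :
    HasFTaylorSeriesUpTo ∞ (fun x => ∫ z, f z x ∂κ) fun x n => ∫ z, p z x n ∂κ := by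
  have hmem (x : E) : x ∈ Metric.ball (0 : E) (‖x‖ + 1) := by simp
  have hint (x : E) (n : ℕ) : Integrable (fun z => p z x n) κ := by
    obtain ⟨g, hg, hle⟩ := hbound n (‖x‖ + 1)
    exact hg.mono' (hmeas x n) (hle.mono fun z hz => hz x (hmem x))
  have hderiv (n : ℕ) (x : E) :
      HasFDerivAt (fun x => ∫ z, p z x n ∂κ) (∫ z, p z x n.succ ∂κ).curryLeft x := by
    obtain ⟨g, hg, hle⟩ := hbound n.succ (‖x‖ + 1)
    exact hasFDerivAt_integral_of_curryLeft
      (fun z x => (hp z).fderiv n (by exact_mod_cast WithTop.coe_lt_top n) x)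
      (fun x => hmeas x n) (hint x n) (hmeas x n.succ) (Metric.isOpen_ball.mem_nhds (hmem x)) hg hle
  refine ⟨fun x => ?_, fun n _ => hderiv n, fun n _ =>
    continuous_iff_continuousAt.2 fun x => (hderiv n x).continuousAt⟩
  rw [ContinuousMultilinearMap.curry0_apply, ContinuousMultilinearMap.integral_apply (hint x 0)]
  exact integral_congr_ae (.of_forall fun z => (hp z).zero_eq x)

end ParametricIntegral

/-- The compensated Lévy–Khintchine integrand `1 - e^{ix} + ix`. -/
noncomputable def levyKernel (x : ℝ) : ℂ := 1 - cexp (I * x) + I * x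

theorem contDiff_levyKernel : ContDiff ℝ ∞ levyKernel := by
  have hcast : ContDiff ℝ ∞ fun x : ℝ => (x : ℂ) := ofRealCLM.contDiff
  unfold levyKernel
  fun_prop

theorem re_levyKernel (x : ℝ) : (levyKernel x).re = 1 - Real.cos x := by
  simp [levyKernel, mul_comm I, exp_ofReal_mul_I_re]

theorem hasDerivAt_exp_I_mul (x : ℝ) :
    HasDerivAt (fun x : ℝ => cexp (I * x)) (I * cexp (I * x)) x := by
  simpa [mul_comm] using (ofRealCLM.hasDerivAt.const_mul I).cexp

theorem hasDerivAt_levyKernel (x : ℝ) : HasDerivAt levyKernel (I * (1 - cexp (I * x))) x := by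
  refine (((hasDerivAt_exp_I_mul x).const_sub 1).add
    (ofRealCLM.hasDerivAt.const_mul I)).congr_deriv ?_
  simp only [ofRealCLM_apply, ofReal_one]
  ring

theorem iteratedDeriv_levyKernel_add_two (n : ℕ) :
    iteratedDeriv (n + 2) levyKernel = fun x : ℝ => -(I ^ (n + 2) * cexp (I * x)) := by
  induction n with
  | zero =>
    rw [iteratedDeriv_succ, iteratedDeriv_one, funext fun x => (hasDerivAt_levyKernel x).deriv]
    refine funext fun x => (((hasDerivAt_exp_I_mul x).const_sub 1).const_mul I).deriv.trans ?_
    ring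
  | succ n ih =>
    rw [iteratedDeriv_succ, ih]
    refine funext fun x => ((hasDerivAt_exp_I_mul x).const_mul _).fun_neg.deriv.trans ?_
    ring

theorem norm_deriv_levyKernel_le (x : ℝ) : ‖deriv levyKernel x‖ ≤ |x| := by
  rw [(hasDerivAt_levyKernel x).deriv, norm_mul, norm_I, one_mul, norm_sub_rev]
  exact Real.norm_exp_I_mul_ofReal_sub_one_le

theorem norm_levyKernel_le (x : ℝ) : ‖levyKernel x‖ ≤ |x| ^ 2 := by
  have hmean := (convex_closedBall (0 : ℝ) |x|).norm_image_sub_le_of_norm_deriv_le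
    (f := levyKernel) (C := |x|) (fun y _ => (hasDerivAt_levyKernel y).differentiableAt)
    (fun y hy => (norm_deriv_levyKernel_le y).trans (by simpa using hy))
    (x := 0) (y := x) (by simp) (by simp)
  simpa [levyKernel, sq] using hmean

theorem norm_iteratedDeriv_levyKernel_le (n : ℕ) (x : ℝ) :
    ‖iteratedDeriv n levyKernel x‖ ≤ |x| ^ (2 - n) := by
  match n with
  | 0 => simpa using norm_levyKernel_le x
  | 1 => simpa using norm_deriv_levyKernel_le x
  | n + 2 => simp [iteratedDeriv_levyKernel_add_two, mul_comm I]

section SmallJumps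

variable {E : Type*} [NormedAddCommGroup E] [MeasurableSpace E] {M : ℝ} {κ : Measure E}

/-- A Lévy measure carried by the unit ball, with second moment at most `M`. -/
structure HasSmallJumps (M : ℝ) (κ : Measure E) : Prop where
  ae_norm_le_one : ∀ᵐ z ∂κ, ‖z‖ ≤ 1
  integrable_norm_sq : Integrable (fun z => ‖z‖ ^ 2) κ
  integral_norm_sq_le : ∫ z, ‖z‖ ^ 2 ∂κ ≤ M

theorem HasSmallJumps.nonneg (hκ : HasSmallJumps M κ) : 0 ≤ M :=
  (integral_nonneg fun z : E => sq_nonneg ‖z‖).trans hκ.integral_norm_sq_le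

theorem HasSmallJumps.restrict (hκ : HasSmallJumps M κ) (s : Set E) :
    HasSmallJumps M (κ.restrict s) where
  ae_norm_le_one := ae_restrict_of_ae hκ.ae_norm_le_one
  integrable_norm_sq := hκ.integrable_norm_sq.restrict
  integral_norm_sq_le :=
    (setIntegral_le_integral hκ.integrable_norm_sq (.of_forall fun z => sq_nonneg ‖z‖)).trans
      hκ.integral_norm_sq_le

theorem HasSmallJumps.isFiniteMeasure_restrict_le_norm (hκ : HasSmallJumps M κ) {r : ℝ}
    (hr : 0 < r) : IsFiniteMeasure (κ.restrict {z | r ≤ ‖z‖}) := by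
  rw [isFiniteMeasure_restrict]
  refine ((measure_mono fun z hz => ?_).trans_lt
    (hκ.integrable_norm_sq.measure_ge_lt_top (pow_pos hr 2))).ne
  exact pow_le_pow_left₀ hr.le hz 2

end SmallJumps

variable {E : Type*} [NormedAddCommGroup E] [InnerProductSpace ℝ E]

/-- The Taylor series in `ξ` of `levyKernel ⟨ξ, z⟩`, the integrand of the Lévy symbol. -/
noncomputable def levyKernelSeries (z ξ : E) : FormalMultilinearSeries ℝ E ℂ := fun n =>
  (iteratedFDeriv ℝ n levyKernel (innerSL ℝ z ξ)).compContinuousLinearMap fun _ => innerSL ℝ z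

theorem hasFTaylorSeriesUpTo_levyKernel_inner (z : E) :
    HasFTaylorSeriesUpTo ∞ (fun ξ => levyKernel (inner ℝ ξ z)) (levyKernelSeries z) := by
  have hkernel : HasFTaylorSeriesUpToOn ∞ levyKernel (ftaylorSeries ℝ levyKernel) univ :=
    hasFTaylorSeriesUpToOn_univ_iff.2 contDiff_levyKernel.ftaylorSeries
  have hcomp : HasFTaylorSeriesUpToOn ∞ (levyKernel ∘ innerSL ℝ z) (levyKernelSeries z) univ :=
    hkernel.compContinuousLinearMap (innerSL ℝ z)
  simpa only [hasFTaylorSeriesUpToOn_univ_iff, Function.comp_def, innerSL_apply_apply,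
    real_inner_comm] using hcomp

theorem norm_levyKernelSeries_le {z : E} (hz : ‖z‖ ≤ 1) (ξ : E) (n : ℕ) :
    ‖levyKernelSeries z ξ n‖ ≤ (1 + ‖ξ‖) ^ 2 * ‖z‖ ^ 2 := by
  calc ‖levyKernelSeries z ξ n‖
      ≤ ‖iteratedFDeriv ℝ n levyKernel (innerSL ℝ z ξ)‖ * ‖z‖ ^ n := by
        refine (ContinuousMultilinearMap.norm_compContinuousLinearMap_le _ _).trans_eq ?_
        simp
    _ ≤ (‖z‖ * ‖ξ‖) ^ (2 - n) * ‖z‖ ^ n := by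
        rw [norm_iteratedFDeriv_eq_norm_iteratedDeriv]
        gcongr
        refine (norm_iteratedDeriv_levyKernel_le n _).trans ?_
        gcongr
        exact abs_real_inner_le_norm z ξ
    _ = ‖ξ‖ ^ (2 - n) * ‖z‖ ^ (2 - n + n) := by rw [mul_pow, pow_add]; ring
    _ ≤ (1 + ‖ξ‖) ^ 2 * ‖z‖ ^ 2 := by
        gcongr ?_ * ?_
        · calc ‖ξ‖ ^ (2 - n) ≤ (1 + ‖ξ‖) ^ (2 - n) := by gcongr; linarith
            _ ≤ (1 + ‖ξ‖) ^ 2 := pow_le_pow_right₀ (by simp) (Nat.sub_le 2 n)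
        · exact pow_le_pow_of_le_one (norm_nonneg _) hz (by lia)

variable [MeasurableSpace E] {κ : Measure E}

/-- The Lévy–Khintchine symbol `∫ (1 - e^{i⟨ξ,z⟩} + i⟨ξ,z⟩) κ(dz)` of a fully compensated pure
jump law; the characteristic function of that law is `exp (-levySymbol κ ξ)`. -/
noncomputable def levySymbol (κ : Measure E) (ξ : E) : ℂ := ∫ z, levyKernel (inner ℝ ξ z) ∂κ

variable [BorelSpace E] [SecondCountableTopology E]

theorem aestronglyMeasurable_levyKernelSeries (ξ : E) (n : ℕ) :
    AEStronglyMeasurable (fun z => levyKernelSeries z ξ n) κ := by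
  have hkernel : Continuous (iteratedFDeriv ℝ n levyKernel) :=
    contDiff_levyKernel.continuous_iteratedFDeriv (by exact_mod_cast le_top)
  have hcomp : Continuous fun z : E =>
      ContinuousMultilinearMap.compContinuousLinearMapContinuousMultilinear ℝ (fun _ => E)
          (fun _ => ℝ) ℂ
        fun _ : Fin n => innerSL ℝ z :=
    (map_continuous _).comp (continuous_pi fun _ => (innerSL ℝ).continuous)
  exact (hcomp.clm_apply (hkernel.comp (by fun_prop :
    Continuous fun z : E => innerSL ℝ z ξ))).aestronglyMeasurable

theorem HasSmallJumps.hasFTaylorSeriesUpTo_levySymbol {M : ℝ} (hκ : HasSmallJumps M κ) :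
    HasFTaylorSeriesUpTo ∞ (levySymbol κ) fun ξ n => ∫ z, levyKernelSeries z ξ n ∂κ := by
  refine hasFTaylorSeriesUpTo_integral hasFTaylorSeriesUpTo_levyKernel_inner
    aestronglyMeasurable_levyKernelSeries fun n R =>
      ⟨fun z => (1 + R) ^ 2 * ‖z‖ ^ 2, hκ.integrable_norm_sq.const_mul _, ?_⟩
  filter_upwards [hκ.ae_norm_le_one] with z hz ξ hξ
  refine (norm_levyKernelSeries_le hz ξ n).trans ?_
  gcongr
  exact (mem_ball_zero_iff.1 hξ).le

theorem HasSmallJumps.contDiff_levySymbol {M : ℝ} (hκ : HasSmallJumps M κ) :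
    ContDiff ℝ ∞ (levySymbol κ) :=
  hκ.hasFTaylorSeriesUpTo_levySymbol.contDiff

theorem HasSmallJumps.norm_iteratedFDeriv_levySymbol_le {M : ℝ} (hκ : HasSmallJumps M κ)
    (n : ℕ) (ξ : E) : ‖iteratedFDeriv ℝ n (levySymbol κ) ξ‖ ≤ (1 + ‖ξ‖) ^ 2 * M := by
  rw [← hκ.hasFTaylorSeriesUpTo_levySymbol.eq_iteratedFDeriv (by exact_mod_cast le_top) ξ]
  calc ‖∫ z, levyKernelSeries z ξ n ∂κ‖
      ≤ ∫ z, (1 + ‖ξ‖) ^ 2 * ‖z‖ ^ 2 ∂κ := by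
        refine norm_integral_le_of_norm_le (hκ.integrable_norm_sq.const_mul _) ?_
        filter_upwards [hκ.ae_norm_le_one] with z hz using norm_levyKernelSeries_le hz ξ n
    _ ≤ (1 + ‖ξ‖) ^ 2 * M := by
        rw [integral_const_mul]
        gcongr
        exact hκ.integral_norm_sq_le

end LevySymbol

section Decay

open Complex SchwartzMap
open scoped ContDiff

theorem norm_iteratedFDeriv_cexp (n : ℕ) (z : ℂ) :
    ‖iteratedFDeriv ℝ n cexp z‖ = ‖cexp z‖ * ‖iteratedFDeriv ℝ n cexp 0‖ := by
  have hshift : (fun w => cexp (w + z)) = cexp z • cexp := by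
    ext w
    simp [Complex.exp_add, mul_comm]
  have htranslate : iteratedFDeriv ℝ n (fun w => cexp (w + z)) 0 = iteratedFDeriv ℝ n cexp z := by
    rw [iteratedFDeriv_comp_add_right, zero_add]
  rw [← htranslate, hshift, iteratedFDeriv_const_smul_apply Complex.contDiff_exp.contDiffAt,
    norm_smul]

theorem one_add_pow_le_mul_one_add_rpow_pow {α x : ℝ} {k n : ℕ} (hx : 0 ≤ x)
    (hkn : (k : ℝ) ≤ α * n) : (1 + x) ^ k ≤ 2 ^ k * (1 + (x ^ α) ^ n) := by
  rcases le_total x 1 with hx₁ | hx₁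
  · calc (1 + x) ^ k ≤ 2 ^ k := by gcongr; linarith
      _ ≤ 2 ^ k * (1 + (x ^ α) ^ n) := le_mul_of_one_le_right (by positivity)
        (le_add_of_nonneg_right (by positivity))
  · calc (1 + x) ^ k ≤ (2 * x) ^ k := by gcongr; linarith
      _ = 2 ^ k * x ^ (k : ℝ) := by rw [mul_pow, Real.rpow_natCast]
      _ ≤ 2 ^ k * x ^ (α * n) := by gcongr
      _ = 2 ^ k * (x ^ α) ^ n := by rw [Real.rpow_mul_natCast hx]
      _ ≤ 2 ^ k * (1 + (x ^ α) ^ n) := by gcongr; linarith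

theorem exists_one_add_pow_mul_exp_neg_rpow_le {α a : ℝ} (hα : 0 < α) (ha : 0 < a) (k : ℕ) :
    ∃ D : ℝ, ∀ x : ℝ, 0 ≤ x → (1 + x) ^ k * Real.exp (-(a * x ^ α)) ≤ D := by
  obtain ⟨n, hn⟩ := exists_nat_ge (k / α)
  refine ⟨2 ^ k * (1 + n.factorial / a ^ n), fun x hx => ?_⟩
  have hnonneg : 0 ≤ a * x ^ α := by positivity
  have hone : Real.exp (-(a * x ^ α)) ≤ 1 := Real.exp_le_one_iff.2 (neg_nonpos.2 hnonneg)
  have hpow : (x ^ α) ^ n * Real.exp (-(a * x ^ α)) ≤ n.factorial / a ^ n := by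
    have := Real.pow_div_factorial_le_exp _ hnonneg n
    rw [Real.exp_neg, ← div_eq_mul_inv, div_le_div_iff₀ (Real.exp_pos _) (by positivity),
      mul_comm, ← mul_pow, mul_comm (n.factorial : ℝ)]
    rwa [div_le_iff₀ (by positivity)] at this
  calc (1 + x) ^ k * Real.exp (-(a * x ^ α))
      ≤ 2 ^ k * (1 + (x ^ α) ^ n) * Real.exp (-(a * x ^ α)) := by
        gcongr
        exact one_add_pow_le_mul_one_add_rpow_pow hx ((div_le_iff₀' hα).1 hn)
    _ = 2 ^ k * (Real.exp (-(a * x ^ α)) + (x ^ α) ^ n * Real.exp (-(a * x ^ α))) := by ring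
    _ ≤ 2 ^ k * (1 + n.factorial / a ^ n) := by gcongr

variable {E : Type*} [NormedAddCommGroup E] [InnerProductSpace ℝ E] [MeasurableSpace E]
  [BorelSpace E] [SecondCountableTopology E]

/-- A Lévy measure with small jumps whose symbol grows at infinity at least like that of an
`α`-stable law. -/
structure HasStableGrowth (α M b : ℝ) (κ : Measure E) : Prop extends HasSmallJumps M κ where
  mul_rpow_sub_one_le_re : ∀ ξ, b * (‖ξ‖ ^ α - 1) ≤ (levySymbol κ ξ).re

variable {κ : Measure E} {α M b : ℝ}

theorem HasSmallJumps.contDiff_exp_neg_levySymbol (hκ : HasSmallJumps M κ) :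
    ContDiff ℝ ∞ fun ξ => cexp (-levySymbol κ ξ) :=
  hκ.contDiff_levySymbol.neg.cexp

theorem HasSmallJumps.norm_iteratedFDeriv_exp_neg_levySymbol_le (hκ : HasSmallJumps M κ) (n : ℕ)
    (ξ : E) :
    ‖iteratedFDeriv ℝ n (fun ξ => cexp (-levySymbol κ ξ)) ξ‖ ≤
      n.factorial * ((∑ i ∈ Finset.range (n + 1), ‖iteratedFDeriv ℝ i cexp 0‖) *
        Real.exp (-(levySymbol κ ξ).re)) * ((1 + ‖ξ‖) ^ 2 * (1 + M)) ^ n := by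
  have hM := hκ.nonneg
  have hone : 1 ≤ (1 + ‖ξ‖) ^ 2 * (1 + M) :=
    one_le_mul_of_one_le_of_one_le (one_le_pow₀ (by simp)) (by simpa)
  refine norm_iteratedFDeriv_comp_le (N := n) (g := cexp) (f := -levySymbol κ)
    Complex.contDiff_exp (hκ.contDiff_levySymbol.neg.of_le (by exact_mod_cast le_top)) le_rfl ξ
    (fun i hi => ?_) fun i hi _ => ?_
  · rw [norm_iteratedFDeriv_cexp, Complex.norm_exp, mul_comm, Pi.neg_apply, neg_re]
    gcongr
    exact Finset.single_le_sum (f := fun i => ‖iteratedFDeriv ℝ i cexp 0‖)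
      (fun _ _ => norm_nonneg _) (Finset.mem_range.2 (Nat.lt_succ_of_le hi))
  · rw [iteratedFDeriv_neg_apply, norm_neg]
    calc ‖iteratedFDeriv ℝ i (levySymbol κ) ξ‖ ≤ (1 + ‖ξ‖) ^ 2 * M :=
          hκ.norm_iteratedFDeriv_levySymbol_le i ξ
      _ ≤ (1 + ‖ξ‖) ^ 2 * (1 + M) := by gcongr; linarith
      _ ≤ ((1 + ‖ξ‖) ^ 2 * (1 + M)) ^ i := le_self_pow₀ hone (Nat.one_le_iff_ne_zero.1 hi)

theorem exists_pow_mul_norm_iteratedFDeriv_exp_neg_levySymbol_le (hα : 0 < α) (hb : 0 < b)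
    (M : ℝ) (k n : ℕ) :
    ∃ D : ℝ, ∀ κ : Measure E, HasStableGrowth α M b κ → ∀ ξ : E,
      ‖ξ‖ ^ k * ‖iteratedFDeriv ℝ n (fun ξ => cexp (-levySymbol κ ξ)) ξ‖ ≤ D := by
  obtain ⟨D, hD⟩ := exists_one_add_pow_mul_exp_neg_rpow_le hα hb (k + 2 * n)
  set S := ∑ i ∈ Finset.range (n + 1), ‖iteratedFDeriv ℝ i cexp 0‖
  have : 0 ≤ S := Finset.sum_nonneg fun _ _ => norm_nonneg _
  refine ⟨n.factorial * S * (1 + M) ^ n * Real.exp b * D, fun κ hκ ξ => ?_⟩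
  have hM := hκ.nonneg
  have hexp : Real.exp (-(levySymbol κ ξ).re) ≤ Real.exp b * Real.exp (-(b * ‖ξ‖ ^ α)) := by
    rw [← Real.exp_add, Real.exp_le_exp]
    linarith [hκ.mul_rpow_sub_one_le_re ξ]
  calc ‖ξ‖ ^ k * ‖iteratedFDeriv ℝ n (fun ξ => cexp (-levySymbol κ ξ)) ξ‖
      ≤ (1 + ‖ξ‖) ^ k * (n.factorial * (S * (Real.exp b * Real.exp (-(b * ‖ξ‖ ^ α)))) *
          ((1 + ‖ξ‖) ^ 2 * (1 + M)) ^ n) := by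
        gcongr ?_ ^ k * ?_
        · linarith
        · refine (hκ.norm_iteratedFDeriv_exp_neg_levySymbol_le n ξ).trans ?_
          gcongr
    _ = n.factorial * S * (1 + M) ^ n * Real.exp b *
          ((1 + ‖ξ‖) ^ (k + 2 * n) * Real.exp (-(b * ‖ξ‖ ^ α))) := by
        rw [pow_add, pow_mul, mul_pow]
        ring
    _ ≤ n.factorial * S * (1 + M) ^ n * Real.exp b * D := by
        gcongr
        exact hD _ (norm_nonneg _)

theorem HasStableGrowth.exists_schwartzMap (hκ : HasStableGrowth α M b κ) (hα : 0 < α)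
    (hb : 0 < b) : ∃ f : 𝓢(E, ℂ), ⇑f = fun ξ => cexp (-levySymbol κ ξ) := by
  choose D hD using exists_pow_mul_norm_iteratedFDeriv_exp_neg_levySymbol_le (E := E) hα hb M
  exact ⟨⟨_, hκ.contDiff_exp_neg_levySymbol, fun k n => ⟨D k n, hD k n κ hκ⟩⟩, rfl⟩

theorem isVonNBounded_setOf_exp_neg_levySymbol (hα : 0 < α) (hb : 0 < b) (M : ℝ) :
    Bornology.IsVonNBounded ℝ {f : 𝓢(E, ℂ) | ∃ κ : Measure E, HasStableGrowth α M b κ ∧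
      ⇑f = fun ξ => cexp (-levySymbol κ ξ)} := by
  rw [(schwartz_withSeminorms ℝ E ℂ).isVonNBounded_iff_seminorm_bounded]
  rintro ⟨k, n⟩
  obtain ⟨D, hD⟩ :=
    exists_pow_mul_norm_iteratedFDeriv_exp_neg_levySymbol_le (E := E) hα hb M k n
  refine ⟨max D 0 + 1, by positivity, ?_⟩
  rintro f ⟨κ, hκ, hf⟩
  exact (SchwartzMap.seminorm_le_bound ℝ k n f (le_max_right D 0)
    fun ξ => hf ▸ (hD κ hκ ξ).trans (le_max_left D 0)).trans_lt (lt_add_one _)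

end Decay

section Positivity

open Complex Filter Topology

variable {E : Type*} [NormedAddCommGroup E] [InnerProductSpace ℝ E] [MeasurableSpace E]

/-- `φ` is the characteristic function of a probability measure. -/
def IsCharFun (φ : E → ℂ) : Prop := ∃ P : Measure E, IsProbabilityMeasure P ∧ charFun P = φ

theorem integrable_cexp_inner_mul_I [OpensMeasurableSpace E] (κ : Measure E) [IsFiniteMeasure κ]
    (ξ : E) : Integrable (fun z => cexp (inner ℝ z ξ * I)) κ :=
  .of_bound (C := 1) (by fun_prop) (.of_forall fun z => (norm_exp_ofReal_mul_I _).le)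

variable [BorelSpace E]

theorem HasSmallJumps.integrable_levyKernel_inner {M : ℝ} {κ : Measure E}
    (hκ : HasSmallJumps M κ) (ξ : E) : Integrable (fun z => levyKernel (inner ℝ ξ z)) κ := by
  have hcont := contDiff_levyKernel.continuous
  refine (hκ.integrable_norm_sq.const_mul (‖ξ‖ ^ 2)).mono'
    (hcont.comp (by fun_prop)).aestronglyMeasurable (.of_forall fun z => ?_)
  calc ‖levyKernel (inner ℝ ξ z)‖ ≤ |inner ℝ ξ z| ^ 2 := norm_levyKernel_le _
    _ ≤ (‖ξ‖ * ‖z‖) ^ 2 := by gcongr; exact abs_real_inner_le_norm ξ z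
    _ = ‖ξ‖ ^ 2 * ‖z‖ ^ 2 := mul_pow ..

theorem HasSmallJumps.tendsto_levySymbol_restrict {M : ℝ} {κ : Measure E}
    (hκ : HasSmallJumps M κ) (ξ : E) :
    Tendsto (fun n : ℕ => levySymbol (κ.restrict {z | 1 / ((n : ℝ) + 1) ≤ ‖z‖}) ξ) atTop
      (𝓝 (levySymbol κ ξ)) := by
  have hmeas (n : ℕ) : MeasurableSet {z : E | 1 / ((n : ℝ) + 1) ≤ ‖z‖} :=
    measurableSet_le measurable_const measurable_norm
  have hint := hκ.integrable_levyKernel_inner ξ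
  simp only [levySymbol, ← integral_indicator (hmeas _)]
  refine tendsto_integral_of_dominated_convergence (fun z => ‖levyKernel (inner ℝ ξ z)‖)
    (fun n => hint.aestronglyMeasurable.indicator (hmeas n)) hint.norm
    (fun n => .of_forall fun z => norm_indicator_le_norm_self _ _) (.of_forall fun z => ?_)
  rcases eq_or_ne z 0 with rfl | hz
  · simp [indicator, levyKernel]
  · refine (tendsto_const_nhds (x := levyKernel (inner ℝ ξ z))).congr' ?_
    filter_upwards [tendsto_one_div_add_atTop_nhds_zero_nat.eventually_lt_const
      (norm_pos_iff.2 hz)] with n hn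
    rw [indicator_of_mem (show z ∈ {z : E | 1 / ((n : ℝ) + 1) ≤ ‖z‖} from hn.le)]

section SecondCountable

variable [SecondCountableTopology E]

namespace IsCharFun

variable {φ ψ : E → ℂ}

theorem mul (hφ : IsCharFun φ) (hψ : IsCharFun ψ) : IsCharFun fun ξ => φ ξ * ψ ξ := by
  obtain ⟨P, _, rfl⟩ := hφ
  obtain ⟨Q, _, rfl⟩ := hψ
  exact ⟨P ∗ Q, inferInstance, funext fun ξ => charFun_conv ξ⟩

omit [SecondCountableTopology E] in
theorem exp_inner (b : E) : IsCharFun fun ξ => cexp (inner ℝ b ξ * I) :=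
  ⟨Measure.dirac b, inferInstance, funext fun ξ => charFun_dirac ξ⟩

theorem pow (hφ : IsCharFun φ) (n : ℕ) : IsCharFun fun ξ => φ ξ ^ n := by
  induction n with
  | zero => simpa using exp_inner (0 : E)
  | succ n ih => simpa only [pow_succ] using ih.mul hφ

end IsCharFun

omit [SecondCountableTopology E] in
theorem isCharFun_one_add_charFun_sub_div (κ : Measure E) [IsFiniteMeasure κ] {x : ℝ}
    (hx : 0 < x) (hκx : κ.real univ ≤ x) :
    IsCharFun fun ξ => 1 + (charFun κ ξ - κ.real univ) / x := by
  have hprob : 0 ≤ 1 - κ.real univ / x := sub_nonneg.2 ((div_le_one hx).2 hκx)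
  refine ⟨ENNReal.ofReal (1 - κ.real univ / x) • .dirac 0 + ENNReal.ofReal x⁻¹ • κ, ⟨?_⟩,
    funext fun ξ => ?_⟩
  · rw [Measure.add_apply, Measure.smul_apply, Measure.smul_apply, measure_univ, smul_eq_mul,
      smul_eq_mul, mul_one, ← ofReal_measureReal, ← ENNReal.ofReal_mul (by positivity),
      ← ENNReal.ofReal_add hprob (by positivity), ← ENNReal.ofReal_one]
    congr 1
    ring
  · have hint (ν : Measure E) [IsFiniteMeasure ν] (c : ℝ) :
        Integrable (fun z => cexp (inner ℝ z ξ * I)) (ENNReal.ofReal c • ν) :=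
      (integrable_cexp_inner_mul_I ν ξ).smul_measure ENNReal.ofReal_ne_top
    rw [charFun_apply, integral_add_measure (hint _ _) (hint _ _), integral_smul_measure,
      integral_smul_measure, ← charFun_apply, ← charFun_apply, charFun_dirac,
      ENNReal.toReal_ofReal hprob, ENNReal.toReal_ofReal (by positivity)]
    simp only [inner_zero_left, real_smul, ofReal_sub, ofReal_div, ofReal_inv, ofReal_one,
      ofReal_zero, zero_mul, Complex.exp_zero]
    ring

theorem HasSmallJumps.levySymbol_eq [CompleteSpace E] {M : ℝ} {κ : Measure E} [IsFiniteMeasure κ]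
    (hκ : HasSmallJumps M κ) (ξ : E) :
    levySymbol κ ξ = κ.real univ - charFun κ ξ + inner ℝ (∫ z, z ∂κ) ξ * I := by
  have hid : Integrable (fun z : E => z) κ :=
    .of_bound (C := 1) (by fun_prop) hκ.ae_norm_le_one
  have hinner : Integrable (fun z => ((inner ℝ ξ z : ℝ) : ℂ) * I) κ :=
    (hid.const_inner ξ).ofReal.mul_const I
  have hexp := integrable_cexp_inner_mul_I κ ξ
  calc levySymbol κ ξ
      = ∫ z, (1 - cexp (inner ℝ z ξ * I) + ((inner ℝ ξ z : ℝ) : ℂ) * I) ∂κ := by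
        simp only [levySymbol, levyKernel, real_inner_comm, mul_comm I]
    _ = κ.real univ - charFun κ ξ + inner ℝ (∫ z, z ∂κ) ξ * I := by
        rw [integral_add (f := fun z => 1 - cexp (inner ℝ z ξ * I))
            ((integrable_const _).sub hexp) hinner, integral_sub (integrable_const _) hexp,
          integral_mul_const, integral_complex_ofReal, integral_inner hid, charFun_apply,
          real_inner_comm ξ, integral_const, real_smul, mul_one]

end SecondCountable

variable [FiniteDimensional ℝ E]

theorem IsCharFun.of_tendsto {φ : ℕ → E → ℂ} {ψ : E → ℂ}
    (hφ : ∀ᶠ n in atTop, IsCharFun (φ n)) (hlim : ∀ ξ, Tendsto (fun n => φ n ξ) atTop (𝓝 (ψ ξ)))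
    (hψ : ContinuousAt ψ 0) : IsCharFun ψ := by
  obtain ⟨k, hk⟩ := eventually_atTop.1 hφ
  choose P hP hchar using fun n => hk (n + k) le_add_self
  have hlim' (ξ : E) : Tendsto (fun n => charFun (P n) ξ) atTop (𝓝 (ψ ξ)) := by
    simpa only [hchar] using (tendsto_add_atTop_iff_nat k).2 (hlim ξ)
  let R : ℕ → ProbabilityMeasure E := fun n => ⟨P n, hP n⟩
  have htight : IsTightMeasureSet
      ((fun μ : ProbabilityMeasure E => (μ : Measure E)) '' range R) := by
    have := isTightMeasureSet_of_tendsto_charFun hψ hlim'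
    rwa [← range_comp]
  obtain ⟨Q, -, θ, hθ, hQ⟩ := (isCompact_closure_of_isTightMeasureSet htight).isSeqCompact
    fun n => subset_closure (mem_range_self n)
  exact ⟨Q, Q.2, funext fun ξ => tendsto_nhds_unique
    (ProbabilityMeasure.tendsto_iff_tendsto_charFun.1 hQ ξ) ((hlim' ξ).comp hθ.tendsto_atTop)⟩

theorem isCharFun_exp_charFun_sub (κ : Measure E) [IsFiniteMeasure κ] :
    IsCharFun fun ξ => cexp (charFun κ ξ - κ.real univ) := by
  refine .of_tendsto (φ := fun n ξ => (1 + (charFun κ ξ - κ.real univ) / (n : ℝ)) ^ n) ?_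
    (fun ξ => by simpa using tendsto_one_add_div_pow_exp _) (by fun_prop)
  filter_upwards [eventually_gt_atTop 0, eventually_ge_atTop ⌈κ.real univ⌉₊] with n hn hκn
  exact (isCharFun_one_add_charFun_sub_div κ (Nat.cast_pos.2 hn) (Nat.ceil_le.1 hκn)).pow n

theorem HasSmallJumps.isCharFun_of_isFiniteMeasure {M : ℝ} {κ : Measure E} [IsFiniteMeasure κ]
    (hκ : HasSmallJumps M κ) : IsCharFun fun ξ => cexp (-levySymbol κ ξ) := by
  convert (isCharFun_exp_charFun_sub κ).mul (.exp_inner (-∫ z, z ∂κ)) using 2 with ξ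
  rw [hκ.levySymbol_eq, ← Complex.exp_add, inner_neg_left]
  push_cast
  ring_nf

theorem HasSmallJumps.isCharFun_exp_neg_levySymbol {M : ℝ} {κ : Measure E}
    (hκ : HasSmallJumps M κ) : IsCharFun fun ξ => cexp (-levySymbol κ ξ) := by
  refine .of_tendsto (.of_forall fun n => ?_)
    (fun ξ => (hκ.tendsto_levySymbol_restrict ξ).neg.cexp)
    hκ.contDiff_exp_neg_levySymbol.continuous.continuousAt
  have := hκ.isFiniteMeasure_restrict_le_norm (Nat.one_div_pos_of_nat (α := ℝ) (n := n))
  exact (hκ.restrict _).isCharFun_of_isFiniteMeasure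

end Positivity

section Density

open Complex ComplexConjugate FourierTransform SchwartzMap

theorem exists_one_add_norm_pow_mul_norm_iteratedFDeriv_le {E F : Type*} [NormedAddCommGroup E]
    [NormedSpace ℝ E] [NormedAddCommGroup F] [NormedSpace ℝ F] {S : Set 𝓢(E, F)}
    (hS : Bornology.IsVonNBounded ℝ S) (k n : ℕ) :
    ∃ C : ℝ, 0 < C ∧ ∀ f ∈ S, ∀ x, (1 + ‖x‖) ^ k * ‖iteratedFDeriv ℝ n f x‖ ≤ C := by
  obtain ⟨C, hC₀, hC⟩ := (schwartz_withSeminorms ℝ E F).isVonNBounded_iff_finset_seminorm_bounded.1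
    hS (Finset.Iic (k, n))
  refine ⟨2 ^ k * C, by positivity, fun f hf x => ?_⟩
  exact (one_add_le_sup_seminorm_apply (𝕜 := ℝ) (m := (k, n)) le_rfl le_rfl f x).trans
    (by gcongr; exact (hC f hf).le)

section Bochner

variable {E : Type*} [NormedAddCommGroup E] [InnerProductSpace ℝ E] [MeasurableSpace E]

theorem charFun_withDensity_ofReal (μ : Measure E) {g : E → ℝ} (hg : AEMeasurable g μ) (ξ : E) :
    charFun (μ.withDensity fun x => ENNReal.ofReal (g x)) ξ =
      ∫ x, ((g x ⊔ 0 : ℝ) : ℂ) * cexp (inner ℝ x ξ * I) ∂μ := by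
  rw [charFun_apply, integral_withDensity_eq_integral_toReal_smul₀ hg.ennreal_ofReal
    (.of_forall fun x => ENNReal.ofReal_lt_top)]
  simp only [ENNReal.toReal_ofReal', real_smul]

variable [BorelSpace E] [SecondCountableTopology E] [CompleteSpace E]

theorem add_withDensity_neg_eq_withDensity {μ P : Measure E} [IsFiniteMeasure P] {g : E → ℝ}
    (hg : Integrable g μ)
    (hP : ∀ ξ, charFun P ξ = ∫ x, (g x : ℂ) * cexp (inner ℝ x ξ * I) ∂μ) :
    P + μ.withDensity (fun x => ENNReal.ofReal (-g x)) =
      μ.withDensity fun x => ENNReal.ofReal (g x) := by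
  have := isFiniteMeasure_withDensity_ofReal hg.2
  have := isFiniteMeasure_withDensity_ofReal hg.neg.2
  have hint {h : E → ℝ} (hh : Integrable h μ) (ξ : E) :
      Integrable (fun x => (h x : ℂ) * cexp (inner ℝ x ξ * I)) μ :=
    hh.ofReal.mul_bdd (c := 1) (by fun_prop) (.of_forall fun x => (norm_exp_ofReal_mul_I _).le)
  refine Measure.ext_of_charFun (funext fun ξ => ?_)
  calc charFun (P + μ.withDensity fun x => ENNReal.ofReal (-g x)) ξ
      = charFun P ξ + charFun (μ.withDensity fun x => ENNReal.ofReal (-g x)) ξ :=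
        integral_add_measure (integrable_cexp_inner_mul_I _ _) (integrable_cexp_inner_mul_I _ _)
    _ = ∫ x, ((g x : ℂ) * cexp (inner ℝ x ξ * I) +
          ((-g x ⊔ 0 : ℝ) : ℂ) * cexp (inner ℝ x ξ * I)) ∂μ := by
        rw [hP, charFun_withDensity_ofReal (g := fun x => -g x) μ hg.1.aemeasurable.neg,
          ← integral_add (hint hg ξ) (hint (h := fun x => -g x ⊔ 0) hg.neg.pos_part ξ)]
    _ = ∫ x, ((g x ⊔ 0 : ℝ) : ℂ) * cexp (inner ℝ x ξ * I) ∂μ := by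
        congr 1 with x
        rw [← add_mul, ← ofReal_add, ← max_add_add_left, add_neg_cancel, add_zero, max_comm]
    _ = charFun (μ.withDensity fun x => ENNReal.ofReal (g x)) ξ :=
        (charFun_withDensity_ofReal μ hg.1.aemeasurable ξ).symm

theorem nonneg_of_charFun_eq_integral {μ P : Measure E} [μ.IsOpenPosMeasure] [IsFiniteMeasure P]
    {g : E → ℝ} (hcont : Continuous g) (hg : Integrable g μ)
    (hP : ∀ ξ, charFun P ξ = ∫ x, (g x : ℂ) * cexp (inner ℝ x ξ * I) ∂μ) (x : E) : 0 ≤ g x := by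
  let s := {x | g x < 0}
  have hs : IsOpen s := isOpen_lt hcont continuous_const
  have hpos : μ.withDensity (fun x => ENNReal.ofReal (g x)) s = 0 := by
    rw [withDensity_apply_eq_zero (by fun_prop)]
    convert measure_empty (μ := μ)
    ext x
    simp +contextual [s, le_of_lt]
  have hneg : μ.withDensity (fun x => ENNReal.ofReal (-g x)) s = 0 :=
    le_antisymm ((Measure.le_add_left le_rfl s).trans_eq
      (by rw [add_withDensity_neg_eq_withDensity hg hP, hpos])) zero_le
  have hsub : s ⊆ {x | ENNReal.ofReal (-g x) ≠ 0} := fun x (hx : g x < 0) => by simpa using hx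
  rw [withDensity_apply_eq_zero (by fun_prop), inter_eq_right.2 hsub, hs.measure_eq_zero_iff μ]
    at hneg
  exact not_lt.1 fun hx => (hneg ▸ hx : x ∈ (∅ : Set E))

theorem eq_withDensity_of_charFun_eq_integral {μ P : Measure E} [μ.IsOpenPosMeasure]
    [IsFiniteMeasure P] {g : E → ℝ} (hcont : Continuous g) (hg : Integrable g μ)
    (hP : ∀ ξ, charFun P ξ = ∫ x, (g x : ℂ) * cexp (inner ℝ x ξ * I) ∂μ) :
    P = μ.withDensity fun x => ENNReal.ofReal (g x) := by
  have hneg (x : E) : ENNReal.ofReal (-g x) = 0 :=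
    ENNReal.ofReal_of_nonpos (neg_nonpos.2 (nonneg_of_charFun_eq_integral hcont hg hP x))
  simpa only [hneg, withDensity_const, zero_smul, add_zero] using
    add_withDensity_neg_eq_withDensity hg hP

end Bochner

variable {E : Type*} [NormedAddCommGroup E] [InnerProductSpace ℝ E] [FiniteDimensional ℝ E]
  [MeasurableSpace E] [BorelSpace E]

variable (E) in
/-- The Fourier transform in angular frequency, `f ↦ (2π)⁻ᵈ ∫ e^{-i⟨ξ, ·⟩} f(ξ) dξ`, which inverts
the convention of `charFun`. -/
noncomputable def angularFourierCLM : 𝓢(E, ℂ) →L[ℝ] 𝓢(E, ℂ) :=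
  (fourierCLM ℝ 𝓢(E, ℂ)).comp <| compCLMOfContinuousLinearEquiv ℝ
    (ContinuousLinearEquiv.smulLeft (Units.mk0 (2 * Real.pi) Real.two_pi_pos.ne'))

theorem integral_angularFourierCLM_mul_cexp (f : 𝓢(E, ℂ)) (ξ : E) :
    ∫ x, angularFourierCLM E f x * cexp (inner ℝ x ξ * I) = f ξ := by
  let g : 𝓢(E, ℂ) := compCLMOfContinuousLinearEquiv ℝ
    (ContinuousLinearEquiv.smulLeft (Units.mk0 (2 * Real.pi) Real.two_pi_pos.ne')) f
  calc ∫ x, angularFourierCLM E f x * cexp (inner ℝ x ξ * I)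
      = ∫ x, cexp ((2 * Real.pi * inner ℝ x ((2 * Real.pi)⁻¹ • ξ) : ℝ) * I) • 𝓕 g x := by
        congr 1 with x
        rw [inner_smul_right, mul_inv_cancel_left₀ Real.two_pi_pos.ne', smul_eq_mul, mul_comm]
        rfl
    _ = g ((2 * Real.pi)⁻¹ • ξ) := by
        rw [← Real.fourierInv_eq', ← fourierInv_coe, fourierInv_fourier_eq]
    _ = f ξ := congrArg f (smul_inv_smul₀ Real.two_pi_pos.ne' ξ)

variable (E) in
/-- The map sending a characteristic function to the density of its law. The real part makes it
real-valued on all Schwartz functions. -/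
noncomputable def densityCLM : 𝓢(E, ℂ) →L[ℝ] 𝓢(E, ℝ) :=
  (postcompCLM reCLM).comp (angularFourierCLM E)

theorem integral_densityCLM_mul_cexp {f : 𝓢(E, ℂ)} (hf : ∀ ξ, f (-ξ) = conj (f ξ)) (ξ : E) :
    ∫ x, (densityCLM E f x : ℂ) * cexp (inner ℝ x ξ * I) = f ξ := by
  let h := angularFourierCLM E f
  have hint (g : E → ℂ) (hg : Integrable g) : Integrable fun x => g x * cexp (inner ℝ x ξ * I) :=
    hg.mul_bdd (c := 1) (by fun_prop) (.of_forall fun x => (norm_exp_ofReal_mul_I _).le)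
  have hbar : Integrable fun x => conj (h x) :=
    conjCLE.toContinuousLinearMap.integrable_comp h.integrable
  have hconj : ∫ x, conj (h x) * cexp (inner ℝ x ξ * I) = f ξ := by
    rw [← conj_conj (f ξ), ← hf, ← integral_angularFourierCLM_mul_cexp, ← integral_conj]
    simp [← exp_conj, h]
  calc ∫ x, (densityCLM E f x : ℂ) * cexp (inner ℝ x ξ * I)
      = ∫ x, (h x * cexp (inner ℝ x ξ * I) + conj (h x) * cexp (inner ℝ x ξ * I)) / 2 := by
        congr 1 with x
        rw [← add_mul, mul_div_right_comm, ← re_eq_add_conj]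
        rfl
    _ = f ξ := by
        rw [integral_div, integral_add (hint _ h.integrable) (hint _ hbar), hconj,
          integral_angularFourierCLM_mul_cexp, add_self_div_two]

theorem charFun_eq_integral_densityCLM {P : Measure E} {f : 𝓢(E, ℂ)} (hf : ⇑f = charFun P)
    (ξ : E) : charFun P ξ = ∫ x, (densityCLM E f x : ℂ) * cexp (inner ℝ x ξ * I) := by
  rw [integral_densityCLM_mul_cexp fun ξ => by rw [hf, charFun_neg], hf]

theorem densityCLM_nonneg {P : Measure E} [IsFiniteMeasure P] {f : 𝓢(E, ℂ)}
    (hf : ⇑f = charFun P) (x : E) : 0 ≤ densityCLM E f x :=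
  nonneg_of_charFun_eq_integral (densityCLM E f).continuous (densityCLM E f).integrable
    (charFun_eq_integral_densityCLM hf) x

theorem eq_withDensity_densityCLM {P : Measure E} [IsFiniteMeasure P] {f : 𝓢(E, ℂ)}
    (hf : ⇑f = charFun P) : P = volume.withDensity fun x => ENNReal.ofReal (densityCLM E f x) :=
  eq_withDensity_of_charFun_eq_integral (densityCLM E f).continuous (densityCLM E f).integrable
    (charFun_eq_integral_densityCLM hf)

theorem exists_schwartz_density {α b : ℝ} (hα : 0 < α) (hb : 0 < b) (M : ℝ) :
    ∃ S : Set 𝓢(E, ℝ), Bornology.IsVonNBounded ℝ S ∧ ∀ κ : Measure E, HasStableGrowth α M b κ →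
      ∃ q ∈ S, (∀ x, 0 ≤ q x) ∧
        IsProbabilityMeasure (volume.withDensity fun x => ENNReal.ofReal (q x)) ∧
        charFun (volume.withDensity fun x => ENNReal.ofReal (q x)) =
          fun ξ => cexp (-levySymbol κ ξ) := by
  refine ⟨_, (isVonNBounded_setOf_exp_neg_levySymbol hα hb M).image (densityCLM E),
    fun κ hκ => ?_⟩
  obtain ⟨f, hf⟩ := hκ.exists_schwartzMap hα hb
  obtain ⟨P, hP, hfP⟩ := hκ.isCharFun_exp_neg_levySymbol
  have hlaw := eq_withDensity_densityCLM (hf.trans hfP.symm)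
  refine ⟨densityCLM E f, mem_image_of_mem _ ⟨κ, hκ, hf⟩,
    densityCLM_nonneg (hf.trans hfP.symm), ?_⟩
  rw [← hlaw]
  exact ⟨hP, hfP⟩

end Density

section Homothety

open Module

variable {E : Type*} [NormedAddCommGroup E] [NormedSpace ℝ E]

theorem map_smul_withDensity [MeasurableSpace E] [BorelSpace E] [FiniteDimensional ℝ E]
    (μ : Measure E) [μ.IsAddHaarMeasure] {l : ℝ} (hl : 0 < l) {f : E → ENNReal}
    (hf : Measurable f) :
    (μ.withDensity f).map (l • ·) =
      μ.withDensity fun x => ENNReal.ofReal (l⁻¹ ^ finrank ℝ E) * f (l⁻¹ • x) := by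
  have hsmul : Measurable fun x : E => l • x := by fun_prop
  have hg : Measurable fun x => f (l⁻¹ • x) := by fun_prop
  have hμ : μ.map (l • ·) = ENNReal.ofReal (l⁻¹ ^ finrank ℝ E) • μ := by
    rw [Measure.map_addHaar_smul μ hl.ne', abs_of_pos (by positivity), inv_pow]
  ext s hs
  calc (μ.withDensity f).map (l • ·) s
      = ∫⁻ x in (l • ·) ⁻¹' s, f (l⁻¹ • l • x) ∂μ := by
        simp only [Measure.map_apply hsmul hs, withDensity_apply _ (hsmul hs),
          inv_smul_smul₀ hl.ne']
    _ = ∫⁻ x in s, f (l⁻¹ • x) ∂μ.map (l • ·) := (setLIntegral_map hs hg hsmul).symm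
    _ = ∫⁻ x in s, ENNReal.ofReal (l⁻¹ ^ finrank ℝ E) * f (l⁻¹ • x) ∂μ := by
        rw [hμ, Measure.restrict_smul, lintegral_smul_measure, lintegral_const_mul _ hg,
          smul_eq_mul]
    _ = _ := (withDensity_apply _ hs).symm

/-- The density of `l X` when `f` is the density of `X`. -/
noncomputable def rescale (l : ℝ) (f : E → ℝ) (x : E) : ℝ := l⁻¹ ^ finrank ℝ E * f (l⁻¹ • x)

theorem map_smul_withDensity_ofReal [MeasurableSpace E] [BorelSpace E] [FiniteDimensional ℝ E]
    (μ : Measure E) [μ.IsAddHaarMeasure] {l : ℝ} (hl : 0 < l) {f : E → ℝ} (hf : Measurable f) :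
    (μ.withDensity fun x => ENNReal.ofReal (f x)).map (l • ·) =
      μ.withDensity fun x => ENNReal.ofReal (rescale l f x) := by
  rw [map_smul_withDensity μ hl (by fun_prop)]
  simp only [rescale, ENNReal.ofReal_mul (pow_nonneg (inv_nonneg.2 hl.le) _)]

theorem rescale_nonneg {l : ℝ} (hl : 0 ≤ l) {f : E → ℝ} (hf : ∀ x, 0 ≤ f x) (x : E) :
    0 ≤ rescale l f x :=
  mul_nonneg (by positivity) (hf _)

theorem contDiff_rescale (l : ℝ) {n : WithTop ℕ∞} {f : E → ℝ} (hf : ContDiff ℝ n f) :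
    ContDiff ℝ n (rescale l f) :=
  contDiff_const.mul (hf.comp (contDiff_const_smul _))

theorem norm_iteratedFDeriv_rescale {l : ℝ} (hl : 0 ≤ l) {n : ℕ} {f : E → ℝ}
    (hf : ContDiff ℝ n f) (x : E) : ‖iteratedFDeriv ℝ n (rescale l f) x‖ =
      l⁻¹ ^ (finrank ℝ E + n) * ‖iteratedFDeriv ℝ n f (l⁻¹ • x)‖ := by
  have hsmul : ContDiff ℝ n fun x => f (l⁻¹ • x) := hf.comp (contDiff_const_smul _)
  change ‖iteratedFDeriv ℝ n (l⁻¹ ^ finrank ℝ E • fun x => f (l⁻¹ • x)) x‖ = _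
  rw [iteratedFDeriv_const_smul_apply hsmul.contDiffAt, iteratedFDeriv_comp_const_smul _ hf,
    smul_smul, ← pow_add, norm_smul, Real.norm_of_nonneg (by positivity)]

end Homothety

section Polar

open Module

variable {N : ℕ}

/-- The measure `dr / r^{1+α}` on `(0, ρ]`. -/
noncomputable def radialMeasure (α ρ : ℝ) : Measure ℝ :=
  (volume.restrict (Ioc 0 ρ)).withDensity fun r => ENNReal.ofReal (1 / r ^ (1 + α))

instance (α ρ : ℝ) : SFinite (radialMeasure α ρ) :=
  inferInstanceAs (SFinite ((volume.restrict (Ioc 0 ρ)).withDensity _))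

theorem ae_radialMeasure_mem (α ρ : ℝ) : ∀ᵐ r ∂radialMeasure α ρ, r ∈ Ioc 0 ρ :=
  (withDensity_absolutelyContinuous _ _).ae_le (ae_restrict_mem measurableSet_Ioc)

theorem radialMeasure_eq_withDensity_indicator (α ρ : ℝ) : radialMeasure α ρ =
    volume.withDensity ((Ioc 0 ρ).indicator fun r => ENNReal.ofReal (1 / r ^ (1 + α))) :=
  (withDensity_indicator measurableSet_Ioc _).symm

theorem radialMeasure_restrict_Iic {α ρ l : ℝ} (hl : l ≤ ρ) :
    (radialMeasure α ρ).restrict (Iic l) = radialMeasure α l := by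
  rw [radialMeasure, restrict_withDensity measurableSet_Iic,
    Measure.restrict_restrict measurableSet_Iic, inter_comm, Ioc_inter_Iic, inf_eq_right.2 hl,
    radialMeasure]

theorem toReal_radialDensity_smul_sq {α r : ℝ} (hr : 0 < r) :
    (ENNReal.ofReal (1 / r ^ (1 + α))).toReal • r ^ 2 = r ^ (1 - α) := by
  rw [ENNReal.toReal_ofReal (by positivity), smul_eq_mul, ← Real.rpow_natCast r 2,
    one_div_mul_eq_div, ← Real.rpow_sub hr]
  norm_num
  ring_nf

theorem integrable_sq_radialMeasure {α : ℝ} (hα : α < 2) {ρ : ℝ} (hρ : 0 ≤ ρ) :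
    Integrable (fun r => r ^ 2) (radialMeasure α ρ) := by
  rw [radialMeasure, integrable_withDensity_iff_integrable_smul' (by fun_prop)
    (.of_forall fun r => ENNReal.ofReal_lt_top)]
  exact ((intervalIntegrable_iff_integrableOn_Ioc_of_le hρ).1
    (intervalIntegral.intervalIntegrable_rpow' (by linarith))).congr_fun
    (fun r hr => (toReal_radialDensity_smul_sq hr.1).symm) measurableSet_Ioc

theorem integral_sq_radialMeasure {α : ℝ} (hα : α < 2) {ρ : ℝ} (hρ : 0 ≤ ρ) :
    ∫ r, r ^ 2 ∂radialMeasure α ρ = ρ ^ (2 - α) / (2 - α) := by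
  rw [radialMeasure, integral_withDensity_eq_integral_toReal_smul (by fun_prop)
    (.of_forall fun r => ENNReal.ofReal_lt_top),
    setIntegral_congr_fun measurableSet_Ioc fun r hr => toReal_radialDensity_smul_sq hr.1,
    ← intervalIntegral.integral_of_le hρ, integral_rpow (.inl (by linarith)),
    Real.zero_rpow (by linarith), sub_zero, show 1 - α + 1 = 2 - α by ring]

theorem map_mul_radialMeasure {α ρ l : ℝ} (hl : 0 < l) :
    (radialMeasure α ρ).map (l * ·) = ENNReal.ofReal (l ^ α) • radialMeasure α (l * ρ) := by
  have hmeas (ρ : ℝ) :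
      Measurable ((Ioc 0 ρ).indicator fun r => ENNReal.ofReal (1 / r ^ (1 + α))) :=
    Measurable.indicator (by fun_prop) measurableSet_Ioc
  rw [radialMeasure_eq_withDensity_indicator, radialMeasure_eq_withDensity_indicator,
    ← withDensity_smul _ (hmeas _)]
  refine (map_smul_withDensity volume hl (hmeas ρ)).trans ?_
  congr 1 with r
  have hmem : l⁻¹ • r ∈ Ioc 0 ρ ↔ r ∈ Ioc 0 (l * ρ) := by
    simp only [smul_eq_mul, mem_Ioc, inv_mul_le_iff₀ hl, mul_pos_iff_of_pos_left (inv_pos.2 hl)]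
  by_cases hr : r ∈ Ioc 0 (l * ρ)
  · rw [indicator_of_mem (hmem.2 hr), Pi.smul_apply, indicator_of_mem hr, smul_eq_mul, smul_eq_mul,
      finrank_self, ← ENNReal.ofReal_mul (by positivity), ← ENNReal.ofReal_mul (by positivity),
      Real.mul_rpow (by positivity) hr.1.le, Real.inv_rpow hl.le, Real.rpow_add hl, Real.rpow_one]
    congr 1
    field_simp
  · rw [indicator_of_notMem (mt hmem.1 hr), Pi.smul_apply, indicator_of_notMem hr, smul_zero,
      mul_zero]

theorem polarMeasure_eq_map_prod (α ρ : ℝ) (σ : Measure (RSp N)) :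
    polarMeasure α ρ σ = ((radialMeasure α ρ).prod σ).map fun p => p.1 • p.2 :=
  rfl

theorem ae_radialMeasure_prod (α ρ : ℝ) {σ : Measure (RSp N)} [SFinite σ]
    (hσ : ∀ᵐ θ ∂σ, ‖θ‖ = 1) :
    ∀ᵐ p ∂(radialMeasure α ρ).prod σ, p.1 ∈ Ioc 0 ρ ∧ ‖p.2‖ = 1 :=
  (Measure.quasiMeasurePreserving_fst.ae (ae_radialMeasure_mem α ρ)).and
    (Measure.quasiMeasurePreserving_snd.ae hσ)

theorem ae_norm_le_polarMeasure (α ρ : ℝ) {σ : Measure (RSp N)} [SFinite σ]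
    (hσ : ∀ᵐ θ ∂σ, ‖θ‖ = 1) : ∀ᵐ z ∂polarMeasure α ρ σ, ‖z‖ ≤ ρ := by
  rw [polarMeasure_eq_map_prod, ae_map_iff (by fun_prop)
    (measurableSet_le measurable_norm measurable_const)]
  filter_upwards [ae_radialMeasure_prod α ρ hσ] with p hp
  rw [norm_smul, hp.2, mul_one, Real.norm_of_nonneg hp.1.1.le]
  exact hp.1.2

theorem polarMeasure_restrict_closedBall {α ρ l : ℝ} (hl : l ≤ ρ) {σ : Measure (RSp N)}
    [SFinite σ] (hσ : ∀ᵐ θ ∂σ, ‖θ‖ = 1) :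
    (polarMeasure α ρ σ).restrict (Metric.closedBall 0 l) = polarMeasure α l σ := by
  have hae : (fun p : ℝ × RSp N => p.1 • p.2) ⁻¹' Metric.closedBall 0 l
      =ᵐ[(radialMeasure α ρ).prod σ] Iic l ×ˢ univ := by
    filter_upwards [ae_radialMeasure_prod α ρ hσ] with p hp
    refine propext ?_
    change p.1 • p.2 ∈ Metric.closedBall 0 l ↔ p ∈ Iic l ×ˢ univ
    simp [norm_smul, hp.2, abs_of_pos hp.1.1]
  rw [polarMeasure_eq_map_prod, Measure.restrict_map (by fun_prop)
    Metric.isClosed_closedBall.measurableSet, Measure.restrict_congr_set hae,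
    ← Measure.prod_restrict, Measure.restrict_univ, radialMeasure_restrict_Iic hl,
    polarMeasure_eq_map_prod]

theorem map_smul_polarMeasure {α ρ l : ℝ} (hl : 0 < l) {σ : Measure (RSp N)} [SFinite σ] :
    (polarMeasure α ρ σ).map (l • ·) = ENNReal.ofReal (l ^ α) • polarMeasure α (l * ρ) σ := by
  have hcomp : (l • ·) ∘ (fun p : ℝ × RSp N => p.1 • p.2) =
      (fun p => p.1 • p.2) ∘ Prod.map (l * ·) id :=
    funext fun p => smul_smul l p.1 p.2
  rw [polarMeasure_eq_map_prod, polarMeasure_eq_map_prod,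
    Measure.map_map (by fun_prop) (by fun_prop), hcomp,
    ← Measure.map_map (by fun_prop) (by fun_prop),
    ← Measure.map_prod_map _ _ (by fun_prop) measurable_id, Measure.map_id,
    map_mul_radialMeasure hl, Measure.prod_smul_left, Measure.map_smul]

section Homogeneous

variable {α ρ : ℝ} {f : RSp N → ℝ}

theorem integrable_polarMeasure_of_homogeneous (hα : α < 2) (hρ : 0 ≤ ρ) {σ : Measure (RSp N)}
    [SFinite σ] (hf : Continuous f) (hf₂ : ∀ (r : ℝ) θ, f (r • θ) = r ^ 2 * f θ)
    (hfσ : Integrable f σ) : Integrable f (polarMeasure α ρ σ) := by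
  rw [polarMeasure_eq_map_prod,
    integrable_map_measure hf.aestronglyMeasurable (by fun_prop)]
  simpa only [Function.comp_def, hf₂] using (integrable_sq_radialMeasure hα hρ).mul_prod hfσ

theorem integral_polarMeasure_of_homogeneous (hα : α < 2) (hρ : 0 ≤ ρ) (σ : Measure (RSp N))
    [SFinite σ] (hf : Continuous f) (hf₂ : ∀ (r : ℝ) θ, f (r • θ) = r ^ 2 * f θ) :
    ∫ z, f z ∂polarMeasure α ρ σ = ρ ^ (2 - α) / (2 - α) * ∫ θ, f θ ∂σ := by
  rw [polarMeasure_eq_map_prod, integral_map (by fun_prop) hf.aestronglyMeasurable]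
  simp only [hf₂]
  rw [integral_prod_mul (fun r => r ^ 2) f, integral_sq_radialMeasure hα hρ]

end Homogeneous

end Polar

section GrowthBound

variable {E : Type*} [NormedAddCommGroup E] [InnerProductSpace ℝ E] [MeasurableSpace E]
  [BorelSpace E] {M : ℝ} {κ : Measure E}

theorem HasSmallJumps.integrable_one_sub_cos_inner (hκ : HasSmallJumps M κ) (ξ : E) :
    Integrable (fun z => 1 - Real.cos (inner ℝ ξ z)) κ := by
  simpa only [RCLike.re_eq_complex_re, re_levyKernel] using (hκ.integrable_levyKernel_inner ξ).re

theorem HasSmallJumps.re_levySymbol (hκ : HasSmallJumps M κ) (ξ : E) :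
    (levySymbol κ ξ).re = ∫ z, (1 - Real.cos (inner ℝ ξ z)) ∂κ := by
  simpa only [RCLike.re_eq_complex_re, re_levyKernel, levySymbol] using
    (integral_re (hκ.integrable_levyKernel_inner ξ)).symm

theorem HasSmallJumps.re_levySymbol_nonneg (hκ : HasSmallJumps M κ) (ξ : E) :
    0 ≤ (levySymbol κ ξ).re := by
  rw [hκ.re_levySymbol ξ]
  exact integral_nonneg fun z => sub_nonneg.2 (Real.cos_le_one _)

theorem HasSmallJumps.integral_inner_sq_le_re_levySymbol (hκ : HasSmallJumps M κ) {ξ : E} {r : ℝ}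
    (hr : r * ‖ξ‖ ≤ Real.pi) :
    2 / Real.pi ^ 2 * ∫ z in Metric.closedBall 0 r, (inner ℝ ξ z) ^ 2 ∂κ ≤
      (levySymbol κ ξ).re := by
  have hcos : ∀ z ∈ Metric.closedBall (0 : E) r,
      2 / Real.pi ^ 2 * (inner ℝ ξ z) ^ 2 ≤ 1 - Real.cos (inner ℝ ξ z) := fun z hz => by
    have hz' : ‖z‖ ≤ r := by simpa using hz
    have hle : |inner ℝ ξ z| ≤ Real.pi := calc
      |inner ℝ ξ z| ≤ ‖ξ‖ * ‖z‖ := abs_real_inner_le_norm ξ z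
      _ ≤ r * ‖ξ‖ := by rw [mul_comm]; gcongr
      _ ≤ Real.pi := hr
    linarith [Real.cos_le_one_sub_mul_cos_sq hle]
  rw [hκ.re_levySymbol ξ, ← integral_const_mul]
  calc ∫ z in Metric.closedBall 0 r, 2 / Real.pi ^ 2 * (inner ℝ ξ z) ^ 2 ∂κ
      ≤ ∫ z in Metric.closedBall 0 r, (1 - Real.cos (inner ℝ ξ z)) ∂κ :=
        integral_mono_of_nonneg (.of_forall fun z => by positivity)
          (hκ.integrable_one_sub_cos_inner ξ).restrict
          ((ae_restrict_mem Metric.isClosed_closedBall.measurableSet).mono hcos)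
    _ ≤ ∫ z, (1 - Real.cos (inner ℝ ξ z)) ∂κ :=
        setIntegral_le_integral (hκ.integrable_one_sub_cos_inner ξ)
          (.of_forall fun z => sub_nonneg.2 (Real.cos_le_one _))

end GrowthBound

namespace IsSphericalWithBounds

open scoped NNReal

variable {N : ℕ} {C : ℝ≥0} {c α : ℝ} {σ : Measure (RSp N)}

theorem isFiniteMeasure (hσ : IsSphericalWithBounds C c σ) : IsFiniteMeasure σ :=
  ⟨hσ.measure_univ_le.trans_lt ENNReal.coe_lt_top⟩

theorem hasSmallJumps (hσ : IsSphericalWithBounds C c σ) (hα : α < 2) :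
    HasSmallJumps (C / (2 - α)) (polarMeasure α 1 σ) := by
  have := hσ.isFiniteMeasure
  have : 0 < 2 - α := by linarith
  have hsq (r : ℝ) (θ : RSp N) : ‖r • θ‖ ^ 2 = r ^ 2 * ‖θ‖ ^ 2 := by
    rw [norm_smul, mul_pow, Real.norm_eq_abs, sq_abs]
  have hone : (fun θ => ‖θ‖ ^ 2) =ᵐ[σ] fun _ => 1 :=
    hσ.ae_norm_eq_one.mono fun θ hθ => by simp only [hθ, one_pow]
  refine ⟨ae_norm_le_polarMeasure α 1 hσ.ae_norm_eq_one,
    integrable_polarMeasure_of_homogeneous hα zero_le_one (by fun_prop) hsq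
      ((integrable_const 1).congr hone.symm), ?_⟩
  rw [integral_polarMeasure_of_homogeneous hα zero_le_one σ (by fun_prop) hsq,
    integral_congr_ae hone, Real.one_rpow, one_div_mul_eq_div, integral_const, smul_eq_mul, mul_one]
  gcongr
  exact ENNReal.toReal_le_coe_of_le_coe hσ.measure_univ_le

theorem mul_rpow_le_re_levySymbol (hσ : IsSphericalWithBounds C c σ) (hα : α < 2) {ξ : RSp N}
    (hξ : 1 ≤ ‖ξ‖) :
    2 / Real.pi ^ 2 * (c / (2 - α)) * ‖ξ‖ ^ α ≤ (levySymbol (polarMeasure α 1 σ) ξ).re := by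
  have := hσ.isFiniteMeasure
  have : 0 < 2 - α := by linarith
  have hξ₀ : 0 < ‖ξ‖ := by linarith
  have hrpow : ‖ξ‖ ^ α = ‖ξ‖⁻¹ ^ (2 - α) * ‖ξ‖ ^ 2 := by
    rw [Real.inv_rpow hξ₀.le, ← Real.rpow_neg hξ₀.le, ← Real.rpow_natCast, ← Real.rpow_add hξ₀]
    norm_num
  calc 2 / Real.pi ^ 2 * (c / (2 - α)) * ‖ξ‖ ^ α
      = 2 / Real.pi ^ 2 * (‖ξ‖⁻¹ ^ (2 - α) / (2 - α) * (c * ‖ξ‖ ^ 2)) := by rw [hrpow]; ring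
    _ ≤ 2 / Real.pi ^ 2 * (‖ξ‖⁻¹ ^ (2 - α) / (2 - α) * ∫ θ, (inner ℝ ξ θ) ^ 2 ∂σ) := by
        gcongr
        exact hσ.mul_norm_sq_le ξ
    _ = 2 / Real.pi ^ 2 *
          ∫ z in Metric.closedBall 0 ‖ξ‖⁻¹, (inner ℝ ξ z) ^ 2 ∂polarMeasure α 1 σ := by
        rw [polarMeasure_restrict_closedBall (inv_le_one_of_one_le₀ hξ) hσ.ae_norm_eq_one,
          integral_polarMeasure_of_homogeneous hα (by positivity) σ (by fun_prop)
            fun r θ => by rw [inner_smul_right, mul_pow]]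
    _ ≤ (levySymbol (polarMeasure α 1 σ) ξ).re :=
        (hσ.hasSmallJumps hα).integral_inner_sq_le_re_levySymbol <| by
          rw [inv_mul_cancel₀ hξ₀.ne']
          linarith [Real.pi_gt_three]

theorem hasStableGrowth (hσ : IsSphericalWithBounds C c σ) (hc : 0 ≤ c) (hα₀ : 0 ≤ α)
    (hα₂ : α < 2) : HasStableGrowth α (C / (2 - α)) (2 / Real.pi ^ 2 * (c / (2 - α)))
      (polarMeasure α 1 σ) where
  toHasSmallJumps := hσ.hasSmallJumps hα₂
  mul_rpow_sub_one_le_re ξ := by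
    have : 0 < 2 - α := by linarith
    have hb : 0 ≤ 2 / Real.pi ^ 2 * (c / (2 - α)) := by positivity
    rcases le_total ‖ξ‖ 1 with hξ | hξ
    · exact (mul_nonpos_of_nonneg_of_nonpos hb
        (sub_nonpos.2 (Real.rpow_le_one (norm_nonneg ξ) hξ hα₀))).trans
          ((hσ.hasSmallJumps hα₂).re_levySymbol_nonneg ξ)
    · linarith [hσ.mul_rpow_le_re_levySymbol hα₂ hξ]

end IsSphericalWithBounds

theorem ofReal_mul_truncSymbol {N d : ℕ} {A : Matrix (Fin N) (Fin N) ℝ}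
    {B : Matrix (Fin N) (Fin d) ℝ} {α r₀ t : ℝ} {μ : Measure (RSp d)}
    [SFinite (sphericalPart A B α μ t)] (hσ : ∀ᵐ θ ∂sphericalPart A B α μ t, ‖θ‖ = 1)
    (hα : α ≠ 0) (ht : 0 < t) (htρ : t ^ (1 / α) ≤ r₀ * transportedInf A B) (ξ : RSp N) :
    t * truncSymbol A B α r₀ μ t ξ =
      levySymbol (polarMeasure α 1 (sphericalPart A B α μ t)) (t ^ (1 / α) • ξ) := by
  set σ := sphericalPart A B α μ t
  have hlα : (t ^ (1 / α)) ^ α = t := by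
    rw [← Real.rpow_mul ht.le, one_div_mul_cancel hα, Real.rpow_one]
  have hcont : Continuous fun z => levyKernel (inner ℝ ξ z) :=
    contDiff_levyKernel.continuous.comp (by fun_prop)
  calc (t : ℂ) * truncSymbol A B α r₀ μ t ξ
      = t * levySymbol (polarMeasure α (t ^ (1 / α)) σ) ξ := by
        rw [levySymbol, ← polarMeasure_restrict_closedBall htρ hσ]
        rfl
    _ = levySymbol ((polarMeasure α 1 σ).map (t ^ (1 / α) • ·)) ξ := by
        rw [map_smul_polarMeasure (Real.rpow_pos_of_pos ht _), hlα, mul_one, levySymbol, levySymbol,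
          integral_smul_measure, ENNReal.toReal_ofReal ht.le, Complex.real_smul]
    _ = levySymbol (polarMeasure α 1 σ) (t ^ (1 / α) • ξ) := by
        rw [levySymbol, integral_map (by fun_prop) hcont.aestronglyMeasurable, levySymbol]
        simp only [real_inner_smul_left, real_inner_smul_right]

section MultiDeriv

open scoped ContDiff

variable {N : ℕ} {f : RSp N → ℝ}

theorem pderivative_iteratedFDeriv (hf : ContDiff ℝ ∞ f) {n : ℕ} (v : Fin n → RSp N) (i : Fin N) :
    pderivative i (fun y => iteratedFDeriv ℝ n f y v) = fun y =>
      iteratedFDeriv ℝ (n + 1) f y (Fin.cons (EuclideanSpace.single i 1) v) := by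
  funext y
  have hdiff : DifferentiableAt ℝ (iteratedFDeriv ℝ n f) y :=
    hf.differentiable_iteratedFDeriv (by exact_mod_cast WithTop.coe_lt_top n) y
  have hderiv := (ContinuousMultilinearMap.apply ℝ (fun _ => RSp N) ℝ v).hasFDerivAt.comp y
    hdiff.hasFDerivAt
  rw [pderivative]
  refine (hderiv.hasLineDerivAt _).lineDeriv.trans ?_
  simp [iteratedFDeriv_succ_apply_left]

theorem exists_iterate_pderivative_iteratedFDeriv (hf : ContDiff ℝ ∞ f) {n : ℕ}
    {v : Fin n → RSp N} (hv : ∀ j, ‖v j‖ ≤ 1) (i : Fin N) (k : ℕ) :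
    ∃ w : Fin (k + n) → RSp N, (∀ j, ‖w j‖ ≤ 1) ∧
      (pderivative i)^[k] (fun y => iteratedFDeriv ℝ n f y v) =
        fun y => iteratedFDeriv ℝ (k + n) f y w := by
  induction k with
  | zero => rw [Nat.zero_add]; exact ⟨v, hv, rfl⟩
  | succ k ih =>
    obtain ⟨w, hw, h⟩ := ih
    rw [Nat.succ_add, Function.iterate_succ_apply', h, pderivative_iteratedFDeriv hf]
    exact ⟨_, Fin.cases (by simp) (by simpa using hw), rfl⟩

theorem exists_foldr_pderivative_eq (hf : ContDiff ℝ ∞ f) (ϑ : Fin N → ℕ) (l : List (Fin N)) :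
    ∃ v : Fin (l.map ϑ).sum → RSp N, (∀ j, ‖v j‖ ≤ 1) ∧
      l.foldr (fun i g => (pderivative i)^[ϑ i] g) f =
        fun y => iteratedFDeriv ℝ (l.map ϑ).sum f y v := by
  induction l with
  | nil => exact ⟨fun _ => 0, by simp, funext fun y => (iteratedFDeriv_zero_apply _).symm⟩
  | cons i l ih =>
    obtain ⟨v, hv, h⟩ := ih
    rw [List.foldr_cons, h, List.map_cons, List.sum_cons]
    exact exists_iterate_pderivative_iteratedFDeriv hf hv i (ϑ i)

theorem abs_multiDeriv_le (hf : ContDiff ℝ ∞ f) (ϑ : Fin N → ℕ) (y : RSp N) :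
    |multiDeriv ϑ f y| ≤ ‖iteratedFDeriv ℝ (∑ i, ϑ i) f y‖ := by
  obtain ⟨v, hv, h⟩ := exists_foldr_pderivative_eq hf ϑ (List.finRange N)
  rw [multiDeriv, h, Fin.sum_univ_def]
  exact ((iteratedFDeriv ℝ _ f y).le_opNorm v).trans
    (mul_le_of_le_one_right (norm_nonneg _)
      (Finset.prod_le_one (fun _ _ => norm_nonneg _) fun j _ => hv j))

theorem abs_multiDeriv_rescale_le (hf : ContDiff ℝ ∞ f) {α t : ℝ} (ht : 0 < t) {C : ℝ}
    {ϑ : Fin N → ℕ} {m : ℕ} (hm : ∑ i, ϑ i ≤ m)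
    (hC : ∀ x, (1 + ‖x‖) ^ (m - ∑ i, ϑ i) * ‖iteratedFDeriv ℝ (∑ i, ϑ i) f x‖ ≤ C) (y : RSp N) :
    |multiDeriv ϑ (rescale (t ^ (1 / α)) f) y| ≤
      C * t ^ (-(((N : ℝ) + (∑ i, ϑ i : ℕ)) / α)) *
        (1 + ‖y‖ / t ^ (1 / α)) ^ (((∑ i, ϑ i : ℕ) : ℤ) - (m : ℤ)) := by
  set k := ∑ i, ϑ i
  have hl : 0 < t ^ (1 / α) := Real.rpow_pos_of_pos ht _
  have hpow : t ^ (-(((N : ℝ) + k) / α)) = (t ^ (1 / α))⁻¹ ^ (N + k) := by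
    rw [← Real.rpow_neg ht.le, ← Real.rpow_natCast, ← Real.rpow_mul ht.le]
    congr 1
    push_cast
    ring
  set l := t ^ (1 / α)
  have hnorm : ‖l⁻¹ • y‖ = ‖y‖ / l := by
    rw [norm_smul, norm_inv, Real.norm_of_nonneg hl.le, inv_mul_eq_div]
  have hzpow : (1 + ‖y‖ / l) ^ ((k : ℤ) - (m : ℤ)) = ((1 + ‖y‖ / l) ^ (m - k))⁻¹ := by
    rw [← zpow_natCast, ← zpow_neg, Nat.cast_sub hm, neg_sub]
  calc |multiDeriv ϑ (rescale l f) y|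
      ≤ ‖iteratedFDeriv ℝ k (rescale l f) y‖ := abs_multiDeriv_le (contDiff_rescale l hf) ϑ y
    _ = l⁻¹ ^ (N + k) * ‖iteratedFDeriv ℝ k f (l⁻¹ • y)‖ := by
        rw [norm_iteratedFDeriv_rescale hl.le (hf.of_le (by exact_mod_cast le_top)),
          finrank_euclideanSpace_fin]
    _ ≤ l⁻¹ ^ (N + k) * (C * ((1 + ‖y‖ / l) ^ (m - k))⁻¹) := by
        gcongr
        rw [← div_eq_mul_inv, le_div_iff₀' (by positivity), ← hnorm]
        exact hC _
    _ = C * t ^ (-(((N : ℝ) + k) / α)) * (1 + ‖y‖ / l) ^ ((k : ℤ) - (m : ℤ)) := by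
        rw [hpow, hzpow]
        ring

end MultiDeriv

theorem isTruncLaw_map_smul {N d : ℕ} {A : Matrix (Fin N) (Fin N) ℝ}
    {B : Matrix (Fin N) (Fin d) ℝ} {α r₀ t : ℝ} {μ : Measure (RSp d)}
    [SFinite (sphericalPart A B α μ t)] (hσ : ∀ᵐ θ ∂sphericalPart A B α μ t, ‖θ‖ = 1)
    (hα : α ≠ 0) (ht : 0 < t) (htρ : t ^ (1 / α) ≤ r₀ * transportedInf A B)
    {P : Measure (RSp N)} [IsProbabilityMeasure P]
    (hP : charFun P = fun ξ =>
      Complex.exp (-levySymbol (polarMeasure α 1 (sphericalPart A B α μ t)) ξ)) :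
    IsTruncLaw A B α r₀ μ t (P.map (t ^ (1 / α) • ·)) where
  isProb := Measure.isProbabilityMeasure_map (by fun_prop)
  charFun_eq ξ := by rw [charFun_map_smul, hP, ofReal_mul_truncSymbol hσ hα ht htρ]

theorem mainTheorem9 (N d : ℕ) (hN : 1 ≤ N)
    (A : Matrix (Fin N) (Fin N) ℝ) (B : Matrix (Fin N) (Fin d) ℝ)
    (hB : B.rank = d) (hK : (kalmanMatrix A B N).rank = N)
    (α : ℝ) (hα₀ : 0 < α) (hα₂ : α < 2) (r₀ : ℝ) (hr₀ : 0 < r₀)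
    (μ : MeasureTheory.Measure (RSp d)) (hμ : IsNondegSpherical α μ) (m : ℕ) :
    ∃ T₀ : ℝ, 0 < T₀ ∧ T₀ ≤ 1 ∧ ∃ p : ℝ → RSp N → ℝ,
      (∀ t ∈ Set.Ioc (0 : ℝ) T₀,
        (∀ y, 0 ≤ p t y) ∧ ContDiff ℝ m (p t) ∧
        IsTruncLaw A B α r₀ μ t
          ((MeasureTheory.volume : MeasureTheory.Measure (RSp N)).withDensity
            fun y => ENNReal.ofReal (p t y))) ∧
      ∀ k : ℕ, k ≤ m → ∃ C : ℝ, 0 < C ∧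
        ∀ ϑ : Fin N → ℕ, ∑ i, ϑ i = k →
          ∀ t ∈ Set.Ioc (0 : ℝ) T₀, ∀ y : RSp N,
            |multiDeriv ϑ (p t) y| ≤
              C * t ^ (-(((N : ℝ) + k) / α)) * (1 + ‖y‖ / t ^ (1 / α)) ^ ((k : ℤ) - (m : ℤ)) := by
  obtain ⟨C, c, hc, hσ⟩ := exists_isSphericalWithBounds hB hK hα₀ hα₂.le hμ
  have hρ : 0 < r₀ * transportedInf A B := mul_pos hr₀ (transportedInf_pos hN hB hK)
  obtain ⟨S, hS, hdensity⟩ := exists_schwartz_density (E := RSp N) hα₀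
    (b := 2 / Real.pi ^ 2 * (c / (2 - α))) (by have := sub_pos.2 hα₂; positivity) (C / (2 - α))
  choose! q hqS hq₀ hqP hqφ using fun t ht =>
    hdensity _ ((hσ t ht).hasStableGrowth hc.le hα₀.le hα₂)
  have hT₀ : ∀ t ∈ Ioc 0 (min 1 ((r₀ * transportedInf A B) ^ α)), t ∈ Ioc (0 : ℝ) 1 :=
    fun t ht => ⟨ht.1, ht.2.trans (min_le_left _ _)⟩
  refine ⟨min 1 ((r₀ * transportedInf A B) ^ α), lt_min one_pos (Real.rpow_pos_of_pos hρ α),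
    min_le_left _ _, fun t => rescale (t ^ (1 / α)) (q t), fun t ht => ?_, fun k hk => ?_⟩
  · have hl : 0 < t ^ (1 / α) := Real.rpow_pos_of_pos ht.1 _
    have htρ : t ^ (1 / α) ≤ r₀ * transportedInf A B := by
      rw [one_div, Real.rpow_inv_le_iff_of_pos ht.1.le hρ.le hα₀]
      exact ht.2.trans (min_le_right _ _)
    have := (hσ t (hT₀ t ht)).isFiniteMeasure
    have := hqP t (hT₀ t ht)
    refine ⟨rescale_nonneg hl.le (hq₀ t (hT₀ t ht)), contDiff_rescale _ ((q t).smooth m), ?_⟩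
    rw [← map_smul_withDensity_ofReal volume hl (q t).continuous.measurable]
    exact isTruncLaw_map_smul (hσ t (hT₀ t ht)).ae_norm_eq_one hα₀.ne' ht.1 htρ (hqφ t (hT₀ t ht))
  · obtain ⟨D, hD₀, hD⟩ := exists_one_add_norm_pow_mul_norm_iteratedFDeriv_le hS (m - k) k
    refine ⟨D, hD₀, ?_⟩
    rintro ϑ rfl t ht
    exact abs_multiDeriv_rescale_le ((q t).smooth ⊤) ht.1 hk (hD _ (hqS t (hT₀ t ht)))
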